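/- Let $n\ge 1$, let $s=(s_1,\dots,s_n)$ be a composition (all $s_i$ positive integers) and set $s_{n+1}=2$. The $s$-oruga graph $G$ has vertices $v_{-1},v_0,\dots,v_n$ and the following edges: for $1\le i\le n+1$, source-edges $e^i_1,\dots,e^i_{s_i-1}$ from $v_{-1}$ to $v_{n+1-i}$; for $1\le i\le n$, two edges $e^i_0$ and $e^i_{s_i}$ from $v_{n-i}$ to $v_{n+1-i}$. It is framed by ordering, at each inner vertex, the incoming edges $e^i_j$ and the outgoing edges $e^{i-1}_j$ by increasing $j$. A route is a directed path from $v_{-1}$ to $v_n$. The routes are exactly the paths $R(k,t,\delta)=(e^k_t,e^{k-1}_{t_{k-1}},\dots,e^1_{t_1})$ with $1\le k\le n+1$, $1\le t\le s_k-1$, $\delta\in\{0,1\}^{k-1}$, $t_j=\delta_j s_j$ for $j<k$; put $t_k=t$. The flow polytope $\mathcal F_G$ is the set of nonnegative vectors $(f_e)_e$ satisfying flow conservation with netflow $1$ at $v_{-1}$, $-1$ at $v_n$ and $0$ elsewhere; the indicator vectors of the routes are its vertices. Compare two partial routes ending (resp. starting) at the same inner vertex by the framing order of the edges at which they last merge (resp.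 first split). Two routes are in conflict at a common subroute between inner vertices $v_i,v_j$ (possibly $v_i=v_j$) if their initial parts up to $v_i$ and their final parts from $v_j$ are strictly ordered in opposite ways, and are coherent if they have no conflict. A clique is a set of pairwise coherent routes. The DKK (Danilov–Karzanov–Koshevoy) triangulation of $\mathcal F_G$ has as maximal cells the simplices $\Delta_C=\operatorname{conv}\{\mathbf 1_R : R\in C\}$, $C$ a maximal clique; its cells are their nonempty faces $\Delta_D$, $\emptyset\ne D\subseteq C$. A function $h$ from the routes to $\mathbb R$ is an admissible height function for this triangulation if the cells (which cover $\mathcal F_G$) are exactly the images, under the projection omitting the last coordinate, of the lower faces of the polytope $\operatorname{conv}\{(\mathbf 1_R,h(R))\}$. For $\varepsilon>0$ define $$h_\varepsilon(R(k,t,\delta))=-\sum_{k\ge c>a\ge 1}\varepsilon^{c-a}(t_c+\delta_a)^2 .$$ Then for all sufficiently small $\varepsilon>0$ the function $h_\varepsilon$ is an admissible height function for the DKK triangulation of $\mathcal F_G$. More precisely, this holds for every $\varepsilon$ with $$0<\varepsilon<\frac{1}{n\bigl(1+\sum_{j=2}^n(2s_j+1)\bigr)} .$$ -/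

import Mathlib

/-! ## Framed graphs, routes and flow polytopes -/

/-- A framed graph on the vertices `0, 1, …, N` with edge set `E` (multiple edges allowed):
every edge goes from a smaller to a larger vertex, `0` is the only source and `N` is the only
sink; the framing is a linear order (given by its strict part) on the set of incoming edges and
on the set of outgoing edges of each inner vertex. -/
structure FramedGraph (N : ℕ) (E : Type) where
  src : E → ℕ
  tgt : E → ℕ
  src_lt_tgt : ∀ e, src e < tgt e
  tgt_le : ∀ e, tgt e ≤ N
  exists_in : ∀ v, 0 < v → v ≤ N → ∃ e, tgt e = v
  exists_out : ∀ v, v < N → ∃ e, src e = v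
  inLT : E → E → Prop
  outLT : E → E → Prop
  inLT_order : ∀ v, 0 < v → v < N →
    IsStrictTotalOrder {e // tgt e = v} (fun e f => inLT e.1 f.1)
  outLT_order : ∀ v, 0 < v → v < N →
    IsStrictTotalOrder {e // src e = v} (fun e f => outLT e.1 f.1)

namespace FramedGraph

variable {N : ℕ} {E : Type} (G : FramedGraph N E)

/-- `G.IsWalk u l w`: the list of edges `l` is a directed path from `u` to `w`. -/
def IsWalk : ℕ → List E → ℕ → Prop
  | u, [], w => u = w
  | u, e :: l, w => G.src e = u ∧ IsWalk (G.tgt e) l w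

/-- A route is a directed path from the source `0` to the sink `N`. -/
def Route : Type := {l : List E // G.IsWalk 0 l N}

/-- The order on partial routes that end at the same inner vertex: compare the edges that enter
the first vertex after which the two partial routes coincide. -/
def PrefixLT (A A' : List E) : Prop :=
  ∃ (A₀ A₀' S : List E) (e f : E), A = A₀ ++ e :: S ∧ A' = A₀' ++ f :: S ∧
    G.tgt e = G.tgt f ∧ G.inLT e f

/-- The order on partial routes that start at the same inner vertex: compare the edges that leave
the last vertex before which the two partial routes coincide. -/
def SuffixLT (B B' : List E) : Prop :=
  ∃ (S B₀ B₀' : List E) (e f : E), B = S ++ e :: B₀ ∧ B' = S ++ f :: B₀' ∧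
    G.src e = G.src f ∧ G.outLT e f

/-- The routes `P` and `Q` are in conflict at a common subroute `M` between the inner vertices
`i` and `j` (possibly `i = j` and `M = []`): the parts of `P` and `Q` before `i` are ordered
differently than the parts after `j`. -/
def InConflictAt (P Q : G.Route) (i j : ℕ) : Prop :=
  ∃ A A' M B B' : List E, P.1 = A ++ M ++ B ∧ Q.1 = A' ++ M ++ B' ∧
    G.IsWalk 0 A i ∧ G.IsWalk 0 A' i ∧ G.IsWalk i M j ∧ G.IsWalk j B N ∧ G.IsWalk j B' N ∧
    ((G.PrefixLT A A' ∧ G.SuffixLT B' B) ∨ (G.PrefixLT A' A ∧ G.SuffixLT B B'))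

/-- Two routes are coherent if they are not in conflict at any common inner subroute. -/
def Coherent (P Q : G.Route) : Prop :=
  ∀ i j, 0 < i → i < N → 0 < j → j < N → ¬ G.InConflictAt P Q i j

/-- A clique is a set of mutually coherent routes. -/
def IsClique (C : Set G.Route) : Prop :=
  ∀ P ∈ C, ∀ Q ∈ C, G.Coherent P Q

/-- The flow polytope: nonnegative flows with netflow `(1, 0, …, 0, -1)`. -/
def flowPolytope [Fintype E] : Set (E → ℝ) :=
  {f | (∀ e, 0 ≤ f e) ∧ ∀ v, v ≤ N →
    (∑ e with G.tgt e = v, f e) + ((if v = 0 then 1 else 0) - (if v = N then 1 else 0)) =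
      ∑ e with G.src e = v, f e}

/-- The indicator vector of a route, a vertex of the flow polytope. -/
noncomputable def routeVector (P : G.Route) : E → ℝ :=
  Set.indicator {e | e ∈ P.1} (fun _ => (1 : ℝ))

/-- `Δ_C`, the convex hull of the vertices of the flow polytope given by the routes in `C`. -/
noncomputable def cliqueSimplex (C : Set G.Route) : Set (E → ℝ) :=
  convexHull ℝ (G.routeVector '' C)

/-- The cells of the Danilov–Karzanov–Koshevoy (DKK) triangulation: the simplices `Δ_C` for the
maximal cliques `C`, together with their nonempty faces `Δ_D`, `D ⊆ C`. -/
def dkkTriangulation : Set (Set (E → ℝ)) :=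
  {F | ∃ C : Set G.Route, Maximal G.IsClique C ∧
    ∃ D : Set G.Route, D ⊆ C ∧ D.Nonempty ∧ F = G.cliqueSimplex D}

end FramedGraph

/-! ## Regular subdivisions -/

section Regular

variable {ι V : Type} [AddCommGroup V] [Module ℝ V]

/-- The lift of the point configuration `a` by the heights `h`. -/
def liftPolytope (a : ι → V) (h : ι → ℝ) : Set (V × ℝ) :=
  convexHull ℝ (Set.range fun i => (a i, h i))

/-- A lower face: the set of minimizers of a linear functional that is positive on the upward
vertical direction. -/
def IsLowerFace (L F : Set (V × ℝ)) : Prop :=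
  ∃ φ : V × ℝ →ₗ[ℝ] ℝ, 0 < φ (0, 1) ∧ F = {x | x ∈ L ∧ ∀ y ∈ L, φ x ≤ φ y}

/-- `h` is an admissible height function for the subdivision `S` (a set of nonempty cells) of the
polytope `K` with vertices `a i`: the cells in `S` cover `K`, and they are exactly the
projections of the lower faces of the lift of `a` by `h`. -/
def IsAdmissibleHeight (K : Set V) (a : ι → V) (S : Set (Set V)) (h : ι → ℝ) : Prop :=
  ⋃₀ S = K ∧ S = {F | ∃ F', IsLowerFace (liftPolytope a h) F' ∧ F = Prod.fst '' F'}

end Regular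

/-! ## The `s`-oruga graph -/

namespace Oruga

variable {n : ℕ}

/-- The `i`-th part `s_i` of the composition `s = (s_1, …, s_n)`, with `s_{n+1} = 2`. -/
def part (s : Fin n → ℕ+) (i : ℕ) : ℕ :=
  if h : 1 ≤ i ∧ i ≤ n then (s ⟨i - 1, by omega⟩ : ℕ) else 2

theorem part_pos (s : Fin n → ℕ+) (i : ℕ) : 0 < part s i := by
  unfold part
  split
  · exact PNat.pos _
  · omega

theorem part_last (s : Fin n → ℕ+) : part s (n + 1) = 2 := by
  simp [part]

/-- The labels `⟨i, j⟩` of the edges `e^i_j`: the source-edges (`1 ≤ i ≤ n + 1`,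
`1 ≤ j ≤ s_i - 1`), and the bumps (`j = 0`) and dips (`j = s_i`) for `1 ≤ i ≤ n`. -/
def edgeLabels (s : Fin n → ℕ+) : Finset (Σ _ : ℕ, ℕ) :=
  (Finset.Icc 1 (n + 1)).sigma (fun i => Finset.Icc 1 (part s i - 1)) ∪
    (Finset.Icc 1 n).sigma (fun i => {0, part s i})

abbrev Edge (s : Fin n → ℕ+) : Type := {e : Σ _ : ℕ, ℕ // e ∈ edgeLabels s}

theorem mem_edgeLabels {s : Fin n → ℕ+} {i j : ℕ} :
    (⟨i, j⟩ : Σ _ : ℕ, ℕ) ∈ edgeLabels s ↔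
      ((1 ≤ i ∧ i ≤ n + 1) ∧ 1 ≤ j ∧ j ≤ part s i - 1) ∨
        ((1 ≤ i ∧ i ≤ n) ∧ (j = 0 ∨ j = part s i)) := by
  simp [edgeLabels]

/-- The `s`-oruga graph with its framing. The vertex `v_i`, `-1 ≤ i ≤ n`, is numbered `i + 1`:
a source-edge `e^i_j` goes from `v_{-1}` to `v_{n+1-i}`, a bump or dip `e^i_j` goes from `v_{n-i}`
to `v_{n+1-i}`. The incoming edges `e^i_j` of a vertex share `i` and are ordered by `j`; so are
the outgoing edges (a bump and a dip) of an inner vertex. -/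
def graph (s : Fin n → ℕ+) : FramedGraph (n + 1) (Edge s) where
  src e := if e.1.2 = 0 ∨ e.1.2 = part s e.1.1 then n + 1 - e.1.1 else 0
  tgt e := n + 2 - e.1.1
  src_lt_tgt := by
    rintro ⟨⟨i, j⟩, h⟩
    rw [mem_edgeLabels] at h
    dsimp only
    split <;> omega
  tgt_le := by
    rintro ⟨⟨i, j⟩, h⟩
    rw [mem_edgeLabels] at h
    dsimp only
    omega
  exists_in := by
    intro v h0 hv
    by_cases h1 : v = 1
    · refine ⟨⟨⟨n + 1, 1⟩, mem_edgeLabels.2 (Or.inl ⟨by omega, by simp [part_last]⟩)⟩, ?_⟩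
      dsimp only
      omega
    · refine ⟨⟨⟨n + 2 - v, 0⟩, mem_edgeLabels.2 (Or.inr ⟨by omega, Or.inl rfl⟩)⟩, ?_⟩
      dsimp only
      omega
  exists_out := by
    intro v hv
    by_cases h1 : v = 0
    · refine ⟨⟨⟨n + 1, 1⟩, mem_edgeLabels.2 (Or.inl ⟨by omega, by simp [part_last]⟩)⟩, ?_⟩
      simp [part_last, h1]
    · refine ⟨⟨⟨n + 1 - v, 0⟩, mem_edgeLabels.2 (Or.inr ⟨by omega, Or.inl rfl⟩)⟩, ?_⟩
      simp only [true_or, if_true]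
      omega
  inLT e f := e.1.2 < f.1.2
  outLT e f := e.1.2 < f.1.2
  inLT_order := by
    intro v _ _
    refine { trichotomous := ?_, irrefl := fun e => lt_irrefl _, trans := fun _ _ _ => lt_trans }
    rintro ⟨⟨⟨i, j⟩, h⟩, he⟩ ⟨⟨⟨i', j'⟩, h'⟩, he'⟩ h1 h2
    rw [mem_edgeLabels] at h h'
    dsimp only at he he' h1 h2
    obtain rfl : i = i' := by omega
    obtain rfl : j = j' := by omega
    rfl
  outLT_order := by
    intro v hv _
    refine { trichotomous := ?_, irrefl := fun e => lt_irrefl _, trans := fun _ _ _ => lt_trans }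
    rintro ⟨⟨⟨i, j⟩, h⟩, he⟩ ⟨⟨⟨i', j'⟩, h'⟩, he'⟩ h1 h2
    rw [mem_edgeLabels] at h h'
    dsimp only at he he' h1 h2
    obtain rfl : i = i' := by
      split at he <;> split at he' <;> omega
    obtain rfl : j = j' := by omega
    rfl

/-- The parameters `(k, t, δ)` of a route: `k ∈ [n+1]`, `t ∈ [1, s_k - 1]` and
`δ = (δ_1, …, δ_{k-1}) ∈ {0,1}^{k-1}`. -/
structure RouteIndex (s : Fin n → ℕ+) where
  k : ℕ
  t : ℕ
  δ : Fin (k - 1) → Fin 2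
  hk : 1 ≤ k ∧ k ≤ n + 1
  ht : 1 ≤ t ∧ t ≤ part s k - 1

/-- The path `e^m_{δ_m s_m}, …, e^1_{δ_1 s_1}` of bumps and dips. -/
def tail (s : Fin n → ℕ+) : (m : ℕ) → m ≤ n → (Fin m → Fin 2) → List (Edge s)
  | 0, _, _ => []
  | m + 1, hm, δ =>
    ⟨⟨m + 1, (δ (Fin.last m) : ℕ) * part s (m + 1)⟩, mem_edgeLabels.2 (Or.inr ⟨by omega, by
      generalize δ (Fin.last m) = d
      fin_cases d <;> simp⟩)⟩ :: tail s m (by omega) (fun i => δ i.castSucc)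

theorem tail_isWalk (s : Fin n → ℕ+) (m : ℕ) (hm : m ≤ n) (δ : Fin m → Fin 2) :
    (graph s).IsWalk (n + 1 - m) (tail s m hm δ) (n + 1) := by
  induction m with
  | zero => simp [tail, FramedGraph.IsWalk]
  | succ m ih =>
    refine ⟨?_, ?_⟩
    · have : ∀ d : Fin 2, (d : ℕ) * part s (m + 1) = 0 ∨
          (d : ℕ) * part s (m + 1) = part s (m + 1) := by
        intro d
        fin_cases d <;> simp
      simp only [graph, this, if_true]
    · have := ih (by omega) (fun i => δ i.castSucc)
      simpa [graph] using this

/-- The route `R(k, t, δ) = (e^k_t, e^{k-1}_{δ_{k-1} s_{k-1}}, …, e^1_{δ_1 s_1})`. -/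
def route (s : Fin n → ℕ+) (r : RouteIndex s) : (graph s).Route :=
  ⟨⟨⟨r.k, r.t⟩, mem_edgeLabels.2 (Or.inl ⟨r.hk, r.ht⟩)⟩ ::
      tail s (r.k - 1) (by have := r.hk; omega) r.δ, by
    have hk := r.hk
    have ht := r.ht
    refine ⟨?_, ?_⟩
    · have : ¬ (r.t = 0 ∨ r.t = part s r.k) := by omega
      simp only [graph, this, if_false]
    · have := tail_isWalk s (r.k - 1) (by omega) r.δ
      have e : n + 2 - r.k = n + 1 - (r.k - 1) := by omega
      simpa [graph, e] using this⟩

theorem tail_injective (s : Fin n → ℕ+) (m : ℕ) (hm : m ≤ n) :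
    Function.Injective (tail s m hm) := by
  induction m with
  | zero => intro _ _ _; exact Subsingleton.elim _ _
  | succ m ih =>
    intro δ δ' h
    simp only [tail, List.cons.injEq, Subtype.mk.injEq, Sigma.mk.injEq, heq_eq_eq, true_and] at h
    have h1 := Nat.eq_of_mul_eq_mul_right (part_pos s (m + 1)) h.1
    have h2 := ih (by omega) h.2
    funext i
    refine Fin.lastCases ?_ (fun j => ?_) i
    · exact Fin.ext h1
    · exact congrFun h2 j

theorem exists_tail (s : Fin n → ℕ+) (m : ℕ) (hm : m ≤ n) (l : List (Edge s))
    (hl : (graph s).IsWalk (n + 1 - m) l (n + 1)) : ∃ δ, l = tail s m hm δ := by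
  induction m generalizing l with
  | zero =>
    cases l with
    | nil => exact ⟨finZeroElim, rfl⟩
    | cons e l =>
      have := (graph s).src_lt_tgt e
      have := (graph s).tgt_le e
      have := hl.1
      omega
  | succ m ih =>
    cases l with
    | nil => have : n + 1 - (m + 1) = n + 1 := hl; omega
    | cons e l =>
      obtain ⟨⟨i, j⟩, he⟩ := e
      obtain ⟨h1, h2⟩ := hl
      have he' := mem_edgeLabels.1 he
      simp only [graph] at h1 h2
      have hj : j = 0 ∨ j = part s i := by
        by_contra hj
        rw [if_neg hj] at h1
        omega
      rw [if_pos hj] at h1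
      obtain rfl : i = m + 1 := by omega
      have e2 : n + 2 - (m + 1) = n + 1 - m := by omega
      rw [e2] at h2
      obtain ⟨δ, rfl⟩ := ih (by omega) l h2
      refine ⟨Fin.snoc δ (if j = 0 then 0 else 1), ?_⟩
      simp only [tail, Fin.snoc_last, Fin.snoc_castSucc]
      congr 3
      split
      · simp_all
      · rcases hj with hj | hj <;> simp_all

/-- Every route of the `s`-oruga graph is `R(k, t, δ)` for exactly one `(k, t, δ)`. -/
theorem route_bijective (s : Fin n → ℕ+) : Function.Bijective (route s) := by
  constructor
  · rintro ⟨k, t, δ, hk, ht⟩ ⟨k', t', δ', hk', ht'⟩ h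
    have h := congrArg Subtype.val h
    simp only [route, List.cons.injEq, Subtype.mk.injEq, Sigma.mk.injEq, heq_eq_eq] at h
    obtain ⟨⟨rfl, rfl⟩, h⟩ := h
    obtain rfl := tail_injective s _ _ h
    rfl
  · rintro ⟨l, hl⟩
    cases l with
    | nil => have : 0 = n + 1 := hl; omega
    | cons e l =>
      obtain ⟨⟨i, j⟩, he⟩ := e
      obtain ⟨h1, h2⟩ := id hl
      have he' := mem_edgeLabels.1 he
      simp only [graph] at h1 h2
      have hj : ¬ (j = 0 ∨ j = part s i) := by
        intro hj
        rw [if_pos hj] at h1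
        rcases he' with h | h <;> omega
      have he2 : (1 ≤ i ∧ i ≤ n + 1) ∧ 1 ≤ j ∧ j ≤ part s i - 1 := by
        rcases he' with h | h
        · exact h
        · exact absurd h.2 hj
      have e2 : n + 2 - i = n + 1 - (i - 1) := by omega
      rw [e2] at h2
      obtain ⟨δ, rfl⟩ := exists_tail s (i - 1) (by omega) l h2
      exact ⟨⟨i, j, δ, he2.1, he2.2⟩, rfl⟩

/-- The parameters `(k, t, δ)` of a route of the `s`-oruga graph. -/
noncomputable def routeEquiv (s : Fin n → ℕ+) : RouteIndex s ≃ (graph s).Route :=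
  Equiv.ofBijective (route s) (route_bijective s)

/-- The entry `δ_a` for `1 ≤ a ≤ k - 1` (and `0` for other `a`). -/
def RouteIndex.δAt {s : Fin n → ℕ+} (r : RouteIndex s) (a : ℕ) : ℕ :=
  if h : 1 ≤ a ∧ a ≤ r.k - 1 then (r.δ ⟨a - 1, by omega⟩ : ℕ) else 0

/-- `t_k = t`, and for `c ≤ k - 1`, `t_c = 0` if `δ_c = 0` and `t_c = s_c` if `δ_c = 1`. -/
def RouteIndex.tAt {s : Fin n → ℕ+} (r : RouteIndex s) (c : ℕ) : ℕ :=
  if c = r.k then r.t else if r.δAt c = 0 then 0 else part s c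

/-- `- ∑_{k ≥ c > a ≥ 1} ε^{c-a} (t_c + δ_a)²`. -/
noncomputable def RouteIndex.height {s : Fin n → ℕ+} (r : RouteIndex s) (ε : ℝ) : ℝ :=
  - ∑ c ∈ Finset.Icc 1 r.k, ∑ a ∈ Finset.Ico 1 c,
    ε ^ (c - a) * ((r.tAt c : ℝ) + (r.δAt a : ℝ)) ^ 2

/-- The function `h_ε` on routes that maps `R(k, t, δ)` to the above quantity. -/
noncomputable def height (s : Fin n → ℕ+) (ε : ℝ) (R : (graph s).Route) : ℝ :=
  ((routeEquiv s).symm R).height ε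

theorem height_route (s : Fin n → ℕ+) (ε : ℝ) (r : RouteIndex s) :
    height s ε (route s r) = r.height ε :=
  congrArg (fun r : RouteIndex s => r.height ε) ((routeEquiv s).symm_apply_apply r)

end Oruga

/-!
The proof combines a criterion for regular triangulations, valid for every finite point
configuration, with two facts on the routes of the oruga graph.

*The criterion* (`isAdmissibleHeight_of_exchange`). Suppose that every incoherent pair of points can
be exchanged for a pair with the same sum and smaller total height, and that nonnegative weights
with pairwise coherent support are determined by their weighted sum. Among all nonnegative weights
with a given sum some have least cost; by exchange their support is coherent, and by uniqueness the
coherent weights are the only ones of least cost. This gives the covering, and the points of a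
lower face are pairwise coherent by the same exchange. Conversely, for a coherent set `D` the
convex hull of the vertical direction and the lifted points outside `D` is disjoint from the span
of the lifted points of `D`, as a common point would yield a second cheapest system of weights.
A functional separating the two (Hahn–Banach) has the simplex on `D` as its lower face.

*Exchange* (`exists_exchange_of_conflict`). In terms of the parameters, two routes `r`, `r'` are
incoherent if and only if, up to swapping them, there are `c > a` such that the edges strictly
between agree while `t_c < t'_c` and `t_a > t'_a`. They are exchanged for the two routes obtained by
swapping the parts of index less than `c`. In the change of the height only the pairs of indices
with one on either side of the swap survive. The pair `(c, a)` gains at least `2 ε ^ (c - a)`, the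
pairs `(c, b)` with `a < b < c` cancel, and all others carry a factor `ε ^ (c - a + 1)` and a
coefficient that the bound on `ε` controls.

*Uniqueness* (`weights_eq_of_flow_eq`). By induction from the source to the sink, the flow
determines the weight of each initial part of a route: in a clique, the initial parts at a vertex
and the edges by which they are continued are ordered in the same way, and a monotone coupling is
determined by its marginals.

That the flow polytope is the convex hull of the indicator vectors of the routes
(`FramedGraph.flowPolytope_eq_convexHull`) holds for every framed graph, by flow decomposition.
-/

/-! ### Lower faces and coherent weights -/

section Regular

variable {ι V : Type} [Fintype ι]

/-- Points of a convex hull as convex combinations, with the weights of the missing points set to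
zero, so that all subsets of the configuration share one index type. -/
theorem mem_convexHull_image_iff_exists_weights {W : Type} [AddCommGroup W] [Module ℝ W]
    (v : ι → W) (D : Set ι) (x : W) :
    x ∈ convexHull ℝ (v '' D) ↔
      ∃ w : ι → ℝ, (∀ i, 0 ≤ w i) ∧ (∀ i, i ∉ D → w i = 0) ∧ ∑ i, w i = 1 ∧
        ∑ i, w i • v i = x := by
  classical
  constructor
  · intro hx
    have hconv : Convex ℝ {y : W | ∃ w : ι → ℝ, (∀ i, 0 ≤ w i) ∧ (∀ i, i ∉ D → w i = 0) ∧
        ∑ i, w i = 1 ∧ ∑ i, w i • v i = y} := by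
      rintro _ ⟨w, hw, hD, h1, rfl⟩ _ ⟨w', hw', hD', h1', rfl⟩ p q hp hq hpq
      refine ⟨fun i => p * w i + q * w' i, fun i => ?_, fun i hi => ?_, ?_, ?_⟩
      · have := hw i
        have := hw' i
        positivity
      · simp [hD i hi, hD' i hi]
      · rw [Finset.sum_add_distrib, ← Finset.mul_sum, ← Finset.mul_sum, h1, h1']
        linarith
      · simp only [add_smul, mul_smul, Finset.sum_add_distrib, Finset.smul_sum]
    refine convexHull_min ?_ hconv hx
    rintro _ ⟨i, hi, rfl⟩
    refine ⟨Pi.single i 1, fun j => ?_, fun j hj => ?_, by simp, ?_⟩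
    · rw [Pi.single_apply]
      split <;> norm_num
    · rw [Pi.single_apply, if_neg]
      rintro rfl
      exact hj hi
    · simp [Pi.single_apply]
  · rintro ⟨w, hw, hD, h1, rfl⟩
    have hsub : ∀ i ∈ Finset.univ, i ∉ Finset.univ.filter (fun i => i ∈ D) → w i = 0 := by
      intro i _ hi
      exact hD i (by simpa using hi)
    rw [← Finset.sum_subset (Finset.filter_subset (fun i => i ∈ D) _)
      (fun i hi hi' => by rw [hsub i hi hi', zero_smul])]
    refine (convex_convexHull ℝ _).sum_mem (fun i _ => hw i) ?_ ?_
    · rw [Finset.sum_subset (Finset.filter_subset _ _) hsub, h1]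
    · intro i hi
      exact subset_convexHull ℝ _ ⟨i, by simpa using hi, rfl⟩

/-- Among the nonnegative weights on a finite point configuration with a given weighted sum there
are some of least cost. The points lie on an affine hyperplane `μ = 1`, so that these weights form
a compact set. -/
theorem exists_weights_minimizing_cost [NormedAddCommGroup V] [NormedSpace ℝ V]
    (a : ι → V) (h : ι → ℝ) (μ : V →ₗ[ℝ] ℝ) (hμ : ∀ i, μ (a i) = 1)
    (w₀ : ι → ℝ) (hw₀ : ∀ i, 0 ≤ w₀ i) :
    ∃ w : ι → ℝ, (∀ i, 0 ≤ w i) ∧ ∑ i, w i • a i = ∑ i, w₀ i • a i ∧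
      ∀ w' : ι → ℝ, (∀ i, 0 ≤ w' i) → ∑ i, w' i • a i = ∑ i, w₀ i • a i →
        ∑ i, w i * h i ≤ ∑ i, w' i * h i := by
  have key : ∀ w : ι → ℝ, μ (∑ i, w i • a i) = ∑ i, w i := by
    intro w
    simp [map_sum, hμ]
  let S : Set (ι → ℝ) := {w | (∀ i, 0 ≤ w i) ∧ ∑ i, w i • a i = ∑ i, w₀ i • a i}
  have hclosed : IsClosed S := by
    refine IsClosed.inter ?_ ?_
    · exact isClosed_le (continuous_const (y := (0 : ι → ℝ))) continuous_id
    · exact isClosed_eq (by fun_prop) continuous_const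
  have hsub : S ⊆ Set.Icc 0 (fun _ => ∑ i, w₀ i) := by
    rintro w ⟨hw, hsum⟩
    refine ⟨hw, fun i => ?_⟩
    have h2 := key w
    rw [hsum, key w₀] at h2
    dsimp only
    rw [h2]
    exact Finset.single_le_sum (fun j _ => hw j) (Finset.mem_univ i)
  have hcomp : IsCompact S := isCompact_Icc.of_isClosed_subset hclosed hsub
  obtain ⟨w, hw, hmin⟩ := hcomp.exists_isMinOn ⟨w₀, hw₀, rfl⟩
    (f := fun w : ι → ℝ => ∑ i, w i * h i) (by fun_prop)
  exact ⟨w, hw.1, hw.2, fun w' h1 h2 => hmin ⟨h1, h2⟩⟩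

/-- Weights of least cost are supported on pairwise coherent points: otherwise some weight could be
moved from an incoherent pair to a cheaper pair with the same sum. -/
theorem coherent_of_minimizing_cost [AddCommGroup V] [Module ℝ V]
    {a : ι → V} {h : ι → ℝ} {Coh : ι → ι → Prop}
    (hswap : ∀ i j, ¬ Coh i j → ∃ i' j', a i + a j = a i' + a j' ∧ h i' + h j' < h i + h j)
    {w : ι → ℝ} (hw : ∀ i, 0 ≤ w i)
    (hmin : ∀ w' : ι → ℝ, (∀ i, 0 ≤ w' i) → ∑ i, w' i • a i = ∑ i, w i • a i →
      ∑ i, w i * h i ≤ ∑ i, w' i * h i)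
    {i j : ι} (hi : w i ≠ 0) (hj : w j ≠ 0) : Coh i j := by
  classical
  by_contra hc
  obtain ⟨i', j', ha, hh⟩ := hswap i j hc
  have hi := lt_of_le_of_ne (hw i) hi.symm
  have hj := lt_of_le_of_ne (hw j) hj.symm
  -- half of the smaller weight can be taken from both points, even if `i = j`
  set d : ℝ := min (w i) (w j) / 2 with hd
  have hd0 : 0 < d := by positivity
  have hdi : 2 * d ≤ w i := by rw [hd]; linarith [min_le_left (w i) (w j)]
  have hdj : 2 * d ≤ w j := by rw [hd]; linarith [min_le_right (w i) (w j)]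
  let S : ι → ι → ℝ := fun p q => if q = p then 1 else 0
  have hS : ∀ p q, 0 ≤ S p q ∧ S p q ≤ 1 := by
    intro p q
    simp only [S]
    split <;> norm_num
  have := hmin (fun q => w q - d * S i q - d * S j q + d * S i' q + d * S j' q) ?_ ?_
  · simp only [add_mul, sub_mul, Finset.sum_add_distrib, Finset.sum_sub_distrib, S, mul_ite,
      ite_mul, mul_one, mul_zero, zero_mul, Finset.sum_ite_eq', Finset.mem_univ, if_true] at this
    nlinarith
  · intro q
    have h1 := hS i' q
    have h2 := hS j' q
    have h3 : d * S i q + d * S j q ≤ w q := by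
      have := hw q
      simp only [S]
      split_ifs <;> subst_vars <;> linarith
    nlinarith [h1.1, h2.1]
  · simp only [add_smul, sub_smul, Finset.sum_add_distrib, Finset.sum_sub_distrib, S, mul_ite,
      ite_smul, mul_one, mul_zero, zero_smul, Finset.sum_ite_eq', Finset.mem_univ, if_true]
    rw [sub_sub, ← smul_add, ha, smul_add]
    abel

/-- The coherent weights with a given sum are the only ones of least cost. -/
theorem eq_of_coherent_of_cost_le [NormedAddCommGroup V] [NormedSpace ℝ V]
    {a : ι → V} {h : ι → ℝ} {Coh : ι → ι → Prop}
    (μ : V →ₗ[ℝ] ℝ) (hμ : ∀ i, μ (a i) = 1)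
    (hswap : ∀ i j, ¬ Coh i j → ∃ i' j', a i + a j = a i' + a j' ∧ h i' + h j' < h i + h j)
    (huniq : ∀ w w' : ι → ℝ, (∀ i, 0 ≤ w i) → (∀ i, 0 ≤ w' i) →
      (∀ i j, w i ≠ 0 → w j ≠ 0 → Coh i j) → (∀ i j, w' i ≠ 0 → w' j ≠ 0 → Coh i j) →
      ∑ i, w i • a i = ∑ i, w' i • a i → w = w')
    {w w' : ι → ℝ} (hw : ∀ i, 0 ≤ w i) (hw' : ∀ i, 0 ≤ w' i)
    (hcoh : ∀ i j, w i ≠ 0 → w j ≠ 0 → Coh i j)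
    (hsum : ∑ i, w' i • a i = ∑ i, w i • a i) (hcost : ∑ i, w' i * h i ≤ ∑ i, w i * h i) :
    w' = w := by
  obtain ⟨m, hm, hmsum, hmin⟩ := exists_weights_minimizing_cost a h μ hμ w hw
  have hmw : m = w := huniq m w hm hw
    (fun i j => coherent_of_minimizing_cost hswap hm (by rwa [hmsum])) hcoh hmsum
  subst hmw
  exact huniq w' m hw' hw
    (fun i j => coherent_of_minimizing_cost hswap hw' (fun u hu hus =>
      hcost.trans (hmin u hu (hus.trans hsum)))) hcoh hsum

/-- For a set `D` of pairwise coherent points some linear functional on the lifted configuration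
vanishes on `D` and is positive on all other points and on the vertical direction. It separates the
convex hull of the latter from the span of the lifted points of `D`; a common point of the two
would give two weights with the same sum, one of them coherent and the other not more costly. -/
theorem exists_functional_of_coherent [NormedAddCommGroup V] [NormedSpace ℝ V]
    {a : ι → V} {h : ι → ℝ} {Coh : ι → ι → Prop}
    (μ : V →ₗ[ℝ] ℝ) (hμ : ∀ i, μ (a i) = 1)
    (hswap : ∀ i j, ¬ Coh i j → ∃ i' j', a i + a j = a i' + a j' ∧ h i' + h j' < h i + h j)
    (huniq : ∀ w w' : ι → ℝ, (∀ i, 0 ≤ w i) → (∀ i, 0 ≤ w' i) →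
      (∀ i j, w i ≠ 0 → w j ≠ 0 → Coh i j) → (∀ i j, w' i ≠ 0 → w' j ≠ 0 → Coh i j) →
      ∑ i, w i • a i = ∑ i, w' i • a i → w = w')
    {D : Set ι} (hD : ∀ i ∈ D, ∀ j ∈ D, Coh i j) :
    ∃ φ : V × ℝ →ₗ[ℝ] ℝ, 0 < φ (0, 1) ∧ (∀ i ∈ D, φ (a i, h i) = 0) ∧
      ∀ i, i ∉ D → 0 < φ (a i, h i) := by
  classical
  let u : Option ι → V × ℝ := fun o => o.elim (0, 1) (fun i => (a i, h i))
  let D' : Set (Option ι) := {o | ∀ i ∈ D, o ≠ some i}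
  let T : Submodule ℝ (V × ℝ) := Submodule.span ℝ (Set.range fun i : D => (a i, h i))
  have hfin : (u '' D').Finite := Set.toFinite _
  have hdisj : Disjoint (convexHull ℝ (u '' D')) (T : Set (V × ℝ)) := by
    rw [Set.disjoint_left]
    intro x hx hxT
    obtain ⟨l, hl, hlD, hl1, hlx⟩ := (mem_convexHull_image_iff_exists_weights u D' x).1 hx
    obtain ⟨c, hc⟩ := (Submodule.mem_span_range_iff_exists_fun ℝ).1 hxT
    let c' : ι → ℝ := fun i => if hi : i ∈ D then c ⟨i, hi⟩ else 0
    have hc' : ∑ i, c' i • ((a i, h i) : V × ℝ) = x := by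
      rw [← hc, ← Finset.sum_subset (Finset.filter_subset (fun i => i ∈ D) Finset.univ)]
      · rw [← Finset.sum_subtype_of_mem (p := fun i => i ∈ D)
          (fun i => c' i • ((a i, h i) : V × ℝ)) (by simp)]
        refine Finset.sum_congr (by ext; simp) ?_
        rintro ⟨i, hi⟩ -
        simp [c', hi]
      · intro i _ hi
        have hi : i ∉ D := by simpa using hi
        simp [c', hi]
    rw [← hlx, Fintype.sum_option] at hc'
    -- a multiple of the sum of all points of `D` makes both sides nonnegative
    let B : ℝ := ∑ i, |c' i|
    have hB : ∀ i, -c' i ≤ B := fun i => (neg_le_abs _).trans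
      (Finset.single_le_sum (f := fun i => |c' i|) (fun j _ => abs_nonneg _) (Finset.mem_univ i))
    have hB0 : 0 ≤ B := Finset.sum_nonneg fun j _ => abs_nonneg _
    let w : ι → ℝ := fun i => c' i + if i ∈ D then B else 0
    let w' : ι → ℝ := fun i => l (some i) + if i ∈ D then B else 0
    have h1 := congrArg Prod.fst hc'
    have h2 := congrArg Prod.snd hc'
    simp only [u, Prod.fst_sum, Prod.snd_sum, Prod.fst_add, Prod.snd_add, Prod.smul_fst,
      Prod.smul_snd, Option.elim, smul_zero, zero_add, smul_eq_mul, mul_one] at h1 h2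
    have hw0 : ∀ i, i ∉ D → w i = 0 := by
      intro i hi
      simp [w, c', hi]
    have heq : w' = w := by
      refine eq_of_coherent_of_cost_le μ hμ hswap huniq (fun i => ?_) (fun i => ?_)
        (fun i j hi hj => hD i ?_ j ?_) ?_ ?_
      · by_cases hi : i ∈ D
        · simp only [w, if_pos hi]
          linarith [hB i]
        · exact (hw0 i hi).ge
      · have := hl (some i)
        simp only [w']
        split <;> linarith
      · by_contra hn
        exact hi (hw0 i hn)
      · by_contra hn
        exact hj (hw0 j hn)
      · simp only [w, w', add_smul, Finset.sum_add_distrib, h1]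
      · simp only [w, w', add_mul, Finset.sum_add_distrib, h2]
        linarith [hl none]
    have hl' : ∀ i, l (some i) = c' i := by
      intro i
      have := congrFun heq i
      simpa [w, w'] using this
    have hl0 : ∀ i, l (some i) = 0 := by
      intro i
      by_cases hi : i ∈ D
      · exact hlD _ (fun hmem => hmem i hi rfl)
      · rw [hl']
        simp [c', hi]
    have hn : l none = 0 := by
      have : ∑ i, l (some i) * h i = ∑ i, c' i * h i :=
        Finset.sum_congr rfl fun i _ => by rw [hl']
      linarith
    rw [Fintype.sum_option, hn] at hl1
    simp [hl0] at hl1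
  have hTclosed : IsClosed (T : Set (V × ℝ)) := by
    have : FiniteDimensional ℝ T := FiniteDimensional.span_of_finite ℝ (Set.toFinite _)
    exact Submodule.closed_of_finiteDimensional T
  obtain ⟨f, p, q, hfp, hpq, hfq⟩ := geometric_hahn_banach_compact_closed
    (convex_convexHull ℝ _) (hfin.isCompact_convexHull ℝ) T.convex hTclosed hdisj
  have hT0 : ∀ x ∈ T, f x = 0 := by
    intro x hx
    by_contra hne
    have := hfq (((q - 1) / f x) • x) (T.smul_mem _ hx)
    rw [map_smul, smul_eq_mul, div_mul_cancel₀ _ hne] at this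
    linarith
  have hq0 : q < 0 := by simpa using hfq 0 T.zero_mem
  have hneg : ∀ o ∈ D', f (u o) < 0 := fun o ho => by
    have := hfp _ (subset_convexHull ℝ _ ⟨o, ho, rfl⟩)
    linarith
  refine ⟨-(f : V × ℝ →ₗ[ℝ] ℝ), ?_, fun i hi => ?_, fun i hi => ?_⟩
  · have := hneg none (fun i _ => by simp)
    simpa [u] using this
  · have := hT0 (a i, h i) (Submodule.subset_span ⟨⟨i, hi⟩, rfl⟩)
    simpa using this
  · have := hneg (some i) (fun j hj hij => hi (by cases hij; exact hj))
    simpa [u] using this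

/-- The face on which a linear functional is least is spanned by the points where it is least. -/
theorem minimizers_convexHull_range [AddCommGroup V] [Module ℝ V] (v : ι → V)
    (φ : V →ₗ[ℝ] ℝ) {m : ℝ} {D : Set ι} (hne : D.Nonempty)
    (hD : ∀ i ∈ D, φ (v i) = m) (hD' : ∀ i, i ∉ D → m < φ (v i)) :
    {x | x ∈ convexHull ℝ (Set.range v) ∧ ∀ y ∈ convexHull ℝ (Set.range v), φ x ≤ φ y} =
      convexHull ℝ (v '' D) := by
  have hle : ∀ i, m ≤ φ (v i) := fun i => by
    by_cases hi : i ∈ D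
    · exact (hD i hi).ge
    · exact (hD' i hi).le
  have hval : ∀ w : ι → ℝ, ∑ i, w i = 1 →
      φ (∑ i, w i • v i) = m + ∑ i, w i * (φ (v i) - m) := by
    intro w hw
    simp only [map_sum, map_smul, smul_eq_mul, mul_sub, Finset.sum_sub_distrib, ← Finset.sum_mul,
      hw]
    ring
  ext x
  rw [mem_convexHull_image_iff_exists_weights]
  constructor
  · rintro ⟨hx, hmin⟩
    rw [← Set.image_univ, mem_convexHull_image_iff_exists_weights] at hx
    obtain ⟨w, hw, -, h1, rfl⟩ := hx
    refine ⟨w, hw, fun i hi => ?_, h1, rfl⟩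
    obtain ⟨i₀, hi₀⟩ := hne
    have h2 := hmin (v i₀) (subset_convexHull ℝ _ ⟨i₀, rfl⟩)
    rw [hD i₀ hi₀, hval w h1] at h2
    have hnn : ∀ j ∈ Finset.univ, 0 ≤ w j * (φ (v j) - m) :=
      fun j _ => mul_nonneg (hw j) (sub_nonneg.2 (hle j))
    have h3 := (Finset.sum_eq_zero_iff_of_nonneg hnn).1
      (le_antisymm (by linarith) (Finset.sum_nonneg hnn)) i (Finset.mem_univ i)
    exact (mul_eq_zero.1 h3).resolve_right (sub_pos.2 (hD' i hi)).ne'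
  · rintro ⟨w, hw, hwD, h1, rfl⟩
    refine ⟨?_, fun y hy => ?_⟩
    · rw [← Set.image_univ, mem_convexHull_image_iff_exists_weights]
      exact ⟨w, hw, fun i hi => (hi (Set.mem_univ i)).elim, h1, rfl⟩
    · rw [← Set.image_univ, mem_convexHull_image_iff_exists_weights] at hy
      obtain ⟨w', hw', -, h1', rfl⟩ := hy
      rw [hval w h1, hval w' h1']
      have h0 : ∑ i, w i * (φ (v i) - m) = 0 := by
        refine Finset.sum_eq_zero fun i _ => ?_
        by_cases hi : i ∈ D
        · rw [hD i hi, sub_self, mul_zero]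
        · rw [hwD i hi, zero_mul]
      rw [h0]
      have := Finset.sum_nonneg fun i (_ : i ∈ Finset.univ) =>
        mul_nonneg (hw' i) (sub_nonneg.2 (hle i))
      linarith

/-- A criterion for admissible heights. If every incoherent pair of points can be exchanged for a
pair with the same sum and smaller total height, and if weights with coherent support are
determined by their weighted sum, then the simplices on coherent sets are the projected lower
faces. -/
theorem isAdmissibleHeight_of_exchange [NormedAddCommGroup V] [NormedSpace ℝ V] [Nonempty ι]
    {a : ι → V} {h : ι → ℝ} {Coh : ι → ι → Prop}
    (μ : V →ₗ[ℝ] ℝ) (hμ : ∀ i, μ (a i) = 1)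
    (hswap : ∀ i j, ¬ Coh i j → ∃ i' j', a i + a j = a i' + a j' ∧ h i' + h j' < h i + h j)
    (huniq : ∀ w w' : ι → ℝ, (∀ i, 0 ≤ w i) → (∀ i, 0 ≤ w' i) →
      (∀ i j, w i ≠ 0 → w j ≠ 0 → Coh i j) → (∀ i j, w' i ≠ 0 → w' j ≠ 0 → Coh i j) →
      ∑ i, w i • a i = ∑ i, w' i • a i → w = w') :
    IsAdmissibleHeight (convexHull ℝ (Set.range a)) a
      {F | ∃ C : Set ι, Maximal (fun C : Set ι => ∀ P ∈ C, ∀ Q ∈ C, Coh P Q) C ∧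
        ∃ D : Set ι, D ⊆ C ∧ D.Nonempty ∧ F = convexHull ℝ (a '' D)} h := by
  have hext : ∀ D : Set ι, (∀ P ∈ D, ∀ Q ∈ D, Coh P Q) →
      ∃ C, D ⊆ C ∧ Maximal (fun C : Set ι => ∀ P ∈ C, ∀ Q ∈ C, Coh P Q) C :=
    fun D hD => Finite.exists_le_maximal hD
  have hproj : ∀ D : Set ι, Prod.fst '' convexHull ℝ ((fun i => (a i, h i)) '' D) =
      convexHull ℝ (a '' D) := by
    intro D
    have := (LinearMap.fst ℝ V ℝ).image_convexHull ((fun i => (a i, h i)) '' D)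
    rw [LinearMap.coe_fst] at this
    rw [this, Set.image_image]
  refine ⟨?_, ?_⟩
  · ext x
    constructor
    · rintro ⟨_, ⟨C, -, D, -, -, rfl⟩, hx⟩
      exact convexHull_mono (Set.image_subset_range _ _) hx
    · intro hx
      rw [← Set.image_univ, mem_convexHull_image_iff_exists_weights] at hx
      obtain ⟨w₀, hw₀, -, h1, rfl⟩ := hx
      obtain ⟨w, hw, hsum, hmin⟩ := exists_weights_minimizing_cost a h μ hμ w₀ hw₀
      have hw1 : ∑ i, w i = 1 := by
        have := congrArg μ hsum
        simpa [map_sum, hμ, h1] using this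
      have hcl : ∀ P ∈ {i | w i ≠ 0}, ∀ Q ∈ {i | w i ≠ 0}, Coh P Q := fun P hP Q hQ =>
        coherent_of_minimizing_cost hswap hw (by rwa [hsum]) hP hQ
      obtain ⟨C, hDC, hC⟩ := hext _ hcl
      refine ⟨_, ⟨C, hC, _, hDC, ?_, rfl⟩, ?_⟩
      · by_contra hemp
        rw [Set.not_nonempty_iff_eq_empty, Set.eq_empty_iff_forall_notMem] at hemp
        have : ∀ i, w i = 0 := fun i => by simpa using hemp i
        simp [this] at hw1
      · rw [mem_convexHull_image_iff_exists_weights]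
        exact ⟨w, hw, fun i hi => by simpa using hi, hw1, hsum⟩
  · ext F
    constructor
    · rintro ⟨C, hC, D, hDC, hne, rfl⟩
      obtain ⟨φ, h0, hφ, hφ'⟩ := exists_functional_of_coherent μ hμ hswap huniq
        (fun P hP Q hQ => hC.prop P (hDC hP) Q (hDC hQ))
      refine ⟨_, ⟨φ, h0, rfl⟩, ?_⟩
      rw [liftPolytope, minimizers_convexHull_range _ φ hne hφ hφ', hproj]
    · rintro ⟨F', ⟨φ, h0, rfl⟩, rfl⟩
      obtain ⟨i₀, hi₀⟩ := Finite.exists_min fun i => φ (a i, h i)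
      have hcl : ∀ P ∈ {i | φ (a i, h i) = φ (a i₀, h i₀)},
          ∀ Q ∈ {i | φ (a i, h i) = φ (a i₀, h i₀)}, Coh P Q := by
        intro P hP Q hQ
        by_contra hc
        obtain ⟨P', Q', ha, hh⟩ := hswap P Q hc
        have e : ∀ i, φ (a i, h i) = φ (a i, 0) + h i * φ (0, 1) := by
          intro i
          rw [← smul_eq_mul, ← map_smul, ← map_add]
          simp
        have e2 : φ (a P, 0) + φ (a Q, 0) = φ (a P', 0) + φ (a Q', 0) := by
          rw [← map_add, ← map_add, Prod.mk_add_mk, Prod.mk_add_mk, ha]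
        have h1 := hi₀ P'
        have h2 := hi₀ Q'
        simp only [Set.mem_ofPred_eq] at hP hQ
        rw [e P'] at h1
        rw [e Q'] at h2
        rw [e P] at hP
        rw [e Q] at hQ
        nlinarith
      obtain ⟨C, hDC, hC⟩ := hext _ hcl
      refine ⟨C, hC, _, hDC, ⟨i₀, rfl⟩, ?_⟩
      rw [liftPolytope, minimizers_convexHull_range _ φ (m := φ (a i₀, h i₀))
        (D := {i | φ (a i, h i) = φ (a i₀, h i₀)}) ⟨i₀, rfl⟩ (fun i hi => hi)
        (fun i hi => lt_of_le_of_ne (hi₀ i) (Ne.symm hi)), hproj]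

end Regular

/-! ### Flows and routes of framed graphs -/

namespace FramedGraph

section Flows

variable {N : ℕ} {E : Type} (G : FramedGraph N E)

theorem isWalk_append (u w : ℕ) (l l' : List E) :
    G.IsWalk u (l ++ l') w ↔ ∃ v, G.IsWalk u l v ∧ G.IsWalk v l' w := by
  induction l generalizing u with
  | nil => simp [IsWalk]
  | cons e l ih => simp [IsWalk, ih, and_assoc]

theorem le_src_of_mem_walk {u w : ℕ} {l : List E} (h : G.IsWalk u l w) {e : E} (he : e ∈ l) :
    u ≤ G.src e := by
  induction l generalizing u with
  | nil => simp at he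
  | cons f l ih =>
    obtain ⟨rfl, h2⟩ := h
    rcases List.mem_cons.1 he with rfl | he
    · exact le_rfl
    · exact (G.src_lt_tgt f).le.trans (ih h2 he)

theorem notMem_of_isWalk_cons {u w : ℕ} {e : E} {l : List E} (h : G.IsWalk u (e :: l) w) :
    e ∉ l := fun he =>
  absurd (G.le_src_of_mem_walk h.2 he) (not_le.2 (G.src_lt_tgt e))

theorem nodup_of_isWalk {u w : ℕ} {l : List E} (h : G.IsWalk u l w) : l.Nodup := by
  induction l generalizing u with
  | nil => exact List.nodup_nil
  | cons e l ih => exact List.nodup_cons.2 ⟨G.notMem_of_isWalk_cons h, ih h.2⟩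

/-- The vertices of a route increase, so a route repeats no edge and there are finitely many. -/
theorem finite_route [Finite E] : Finite G.Route := by
  classical
  have := Fintype.ofFinite E
  exact Finite.of_injective
    (fun P : G.Route => (⟨P.1, G.nodup_of_isWalk P.2⟩ : {l : List E // l.Nodup}))
    fun P Q h => Subtype.ext (Subtype.mk.inj h)

variable [Fintype E]

/-- The netflow of the indicator vector of a path: the path adds one to the inflow or the outflow
of a vertex each time it enters or leaves it. -/
theorem sum_indicator_walk {u w : ℕ} {l : List E} (h : G.IsWalk u l w) (v : ℕ) :
    (∑ e with G.tgt e = v, Set.indicator {e | e ∈ l} (fun _ => (1 : ℝ)) e) +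
        ((if v = u then 1 else 0) - (if v = w then 1 else 0)) =
      ∑ e with G.src e = v, Set.indicator {e | e ∈ l} (fun _ => (1 : ℝ)) e := by
  classical
  induction l generalizing u with
  | nil =>
    obtain rfl : u = w := h
    simp
  | cons e l ih =>
    have hsplit : ∀ f, Set.indicator {f | f ∈ e :: l} (fun _ => (1 : ℝ)) f =
        (if f = e then 1 else 0) + Set.indicator {f | f ∈ l} (fun _ => (1 : ℝ)) f := by
      intro f
      have hne := G.notMem_of_isWalk_cons h
      by_cases hf : f = e
      · subst hf
        simp [hne]
      · simp [Set.indicator_apply, hf]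
    have hone : ∀ p : E → ℕ, (∑ f with p f = v, if f = e then (1 : ℝ) else 0) =
        if v = p e then 1 else 0 := by
      intro p
      simp [eq_comm]
    obtain ⟨rfl, h2⟩ := h
    have := ih h2
    simp only [hsplit, Finset.sum_add_distrib, hone]
    linarith

theorem routeVector_mem_flowPolytope (P : G.Route) : G.routeVector P ∈ G.flowPolytope :=
  ⟨fun _ => Set.indicator_nonneg (fun _ _ => zero_le_one) _,
    fun v _ => G.sum_indicator_walk P.2 v⟩

theorem convex_flowPolytope : Convex ℝ G.flowPolytope := by
  rintro f ⟨hf, hf'⟩ g ⟨hg, hg'⟩ p q hp hq hpq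
  refine ⟨fun e => ?_, fun v hv => ?_⟩
  · have := hf e
    have := hg e
    simp only [Pi.add_apply, Pi.smul_apply, smul_eq_mul]
    positivity
  · simp only [Pi.add_apply, Pi.smul_apply, smul_eq_mul, Finset.sum_add_distrib, ← Finset.mul_sum,
      ← hf' v hv, ← hg' v hv]
    linear_combination (-(if v = 0 then (1 : ℝ) else 0) + (if v = N then 1 else 0)) * hpq

/-- A nonnegative function on the edges whose inflow and outflow agree at each inner vertex. -/
def IsCirculation (g : E → ℝ) : Prop :=
  (∀ e, 0 ≤ g e) ∧ ∀ v, 0 < v → v < N →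
    ∑ e with G.tgt e = v, g e = ∑ e with G.src e = v, g e

variable {G}

theorem IsCirculation.exists_pos_walk_to_sink {g : E → ℝ} (hg : G.IsCirculation g) :
    ∀ e, 0 < g e → ∃ l, G.IsWalk (G.tgt e) l N ∧ ∀ f ∈ l, 0 < g f := by
  intro e
  induction hm : N - G.tgt e using Nat.strong_induction_on generalizing e with
  | _ m ih =>
    intro he
    have hle := G.tgt_le e
    by_cases hN : G.tgt e = N
    · exact ⟨[], hN, by simp⟩
    have hpos : 0 < ∑ f with G.src f = G.tgt e, g f := by
      rw [← hg.2 _ (by have := G.src_lt_tgt e; omega) (by omega)]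
      exact he.trans_le (Finset.single_le_sum (f := g) (fun f _ => hg.1 f) (by simp))
    obtain ⟨f, hf, hf0⟩ := Finset.exists_lt_of_sum_lt (f := fun _ => (0 : ℝ)) (by simpa using hpos)
    have hf : G.src f = G.tgt e := by simpa using hf
    have h1 := G.src_lt_tgt f
    have h2 := G.tgt_le f
    obtain ⟨l, hl, hl0⟩ := ih (N - G.tgt f) (by omega) f rfl hf0
    exact ⟨f :: l, ⟨hf, hl⟩, by simpa using ⟨hf0, hl0⟩⟩

theorem IsCirculation.exists_pos_walk_from_source {g : E → ℝ} (hg : G.IsCirculation g) :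
    ∀ e, 0 < g e → ∃ l, G.IsWalk 0 l (G.src e) ∧ ∀ f ∈ l, 0 < g f := by
  intro e
  induction hm : G.src e using Nat.strong_induction_on generalizing e with
  | _ m ih =>
    intro he
    by_cases h0 : G.src e = 0
    · exact ⟨[], by rw [← hm, h0]; rfl, by simp⟩
    have hpos : 0 < ∑ f with G.tgt f = G.src e, g f := by
      rw [hg.2 _ (by omega) ((G.src_lt_tgt e).trans_le (G.tgt_le e))]
      exact he.trans_le (Finset.single_le_sum (f := g) (fun f _ => hg.1 f) (by simp))
    obtain ⟨f, hf, hf0⟩ := Finset.exists_lt_of_sum_lt (f := fun _ => (0 : ℝ)) (by simpa using hpos)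
    have hf : G.tgt f = G.src e := by simpa using hf
    have h1 := G.src_lt_tgt f
    obtain ⟨l, hl, hl0⟩ := ih (G.src f) (by omega) f rfl hf0
    refine ⟨l ++ [f], ?_, ?_⟩
    · rw [G.isWalk_append]
      exact ⟨_, hl, rfl, by rw [hf, hm]; rfl⟩
    · intro f' hf'
      rcases List.mem_append.1 hf' with h | h
      · exact hl0 f' h
      · rw [List.mem_singleton.1 h]
        exact hf0

theorem IsCirculation.exists_pos_route {g : E → ℝ} (hg : G.IsCirculation g) {e : E}
    (he : 0 < g e) : ∃ P : G.Route, e ∈ P.1 ∧ ∀ f ∈ P.1, 0 < g f := by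
  obtain ⟨l, hl, hl0⟩ := hg.exists_pos_walk_from_source e he
  obtain ⟨l', hl', hl0'⟩ := hg.exists_pos_walk_to_sink e he
  refine ⟨⟨l ++ e :: l', (G.isWalk_append _ _ _ _).2 ⟨_, hl, rfl, hl'⟩⟩, by simp, ?_⟩
  intro f hf
  rcases List.mem_append.1 hf with h | h
  · exact hl0 f h
  · rcases List.mem_cons.1 h with rfl | h
    · exact he
    · exact hl0' f h

/-- Flow decomposition: subtracting as much as possible along a route with positive flow makes the
flow vanish on one more edge. -/
theorem IsCirculation.exists_route_weights [Fintype G.Route] {g : E → ℝ}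
    (hg : G.IsCirculation g) :
    ∃ w : G.Route → ℝ, (∀ P, 0 ≤ w P) ∧ ∑ P, w P • G.routeVector P = g := by
  classical
  induction hm : (Finset.univ.filter fun e => g e ≠ 0).card using Nat.strong_induction_on
    generalizing g with
  | _ m ih =>
    by_cases hz : ∀ e, g e = 0
    · exact ⟨0, fun _ => le_rfl, by ext e; simp [hz]⟩
    push Not at hz
    obtain ⟨e₀, he₀⟩ := hz
    obtain ⟨P, hP, hpos⟩ := hg.exists_pos_route (lt_of_le_of_ne (hg.1 e₀) he₀.symm)
    obtain ⟨e₁, he₁, hmin⟩ := Finset.exists_min_image P.1.toFinset g ⟨e₀, by simpa using hP⟩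
    rw [List.mem_toFinset] at he₁
    have hrv : ∀ e, G.routeVector P e = if e ∈ P.1 then 1 else 0 := fun e => by
      simp [routeVector, Set.indicator_apply]
    have hg' : G.IsCirculation (g - g e₁ • G.routeVector P) := by
      refine ⟨fun e => ?_, fun v h0 hN => ?_⟩
      · simp only [Pi.sub_apply, Pi.smul_apply, smul_eq_mul, hrv]
        split_ifs with h
        · have := hmin e (by simpa using h)
          linarith
        · have := hg.1 e
          linarith
      · have h1 := (G.routeVector_mem_flowPolytope P).2 v hN.le
        rw [if_neg h0.ne', if_neg hN.ne, sub_zero, add_zero] at h1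
        simp only [Pi.sub_apply, Pi.smul_apply, smul_eq_mul, Finset.sum_sub_distrib,
          ← Finset.mul_sum, h1, hg.2 v h0 hN]
    have hcard : (Finset.univ.filter fun e => (g - g e₁ • G.routeVector P) e ≠ 0).card < m := by
      rw [← hm]
      refine Finset.card_lt_card ⟨fun e he => ?_, fun hsub => ?_⟩
      · rw [Finset.mem_filter] at he ⊢
        refine ⟨he.1, fun h => he.2 ?_⟩
        have : e ∉ P.1 := fun hmem => (hpos e hmem).ne' h
        simp [hrv, this, h]
      · have := hsub (Finset.mem_filter.2 ⟨Finset.mem_univ e₁, (hpos e₁ he₁).ne'⟩)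
        simp [hrv, he₁] at this
    obtain ⟨w, hw, hsum⟩ := ih _ hcard hg' rfl
    refine ⟨fun Q => w Q + if Q = P then g e₁ else 0, fun Q => ?_, ?_⟩
    · have := hw Q
      have := hg.1 e₁
      dsimp only
      split_ifs <;> linarith
    · simp only [add_smul, Finset.sum_add_distrib, hsum, ite_smul, zero_smul,
        Finset.sum_ite_eq', Finset.mem_univ, if_true, sub_add_cancel]

variable (G)

/-- The amount of flow that leaves the source. -/
noncomputable def sourceFlow : (E → ℝ) →ₗ[ℝ] ℝ :=
  ∑ e with G.src e = 0, LinearMap.proj e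

theorem sourceFlow_apply (f : E → ℝ) : G.sourceFlow f = ∑ e with G.src e = 0, f e := by
  simp [sourceFlow, LinearMap.sum_apply]

theorem sourceFlow_of_mem_flowPolytope (hN : 0 < N) {f : E → ℝ} (hf : f ∈ G.flowPolytope) :
    G.sourceFlow f = 1 := by
  have h : ∑ e with G.tgt e = 0, f e = 0 := by
    refine Finset.sum_eq_zero fun e he => ?_
    have := G.src_lt_tgt e
    have he : G.tgt e = 0 := by simpa using he
    omega
  rw [sourceFlow_apply, ← hf.2 0 (Nat.zero_le _), h]
  simp [hN.ne]

/-- Every vector of the flow polytope is a convex combination of indicator vectors of routes. -/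
theorem flowPolytope_eq_convexHull (hN : 0 < N) :
    G.flowPolytope = convexHull ℝ (Set.range G.routeVector) := by
  have := G.finite_route
  have := Fintype.ofFinite G.Route
  refine Set.Subset.antisymm (fun f hf => ?_) (convexHull_min ?_ G.convex_flowPolytope)
  · have hcirc : G.IsCirculation f := ⟨hf.1, fun v h0 hv => by
      simpa [h0.ne', hv.ne] using hf.2 v hv.le⟩
    obtain ⟨w, hw, hsum⟩ := hcirc.exists_route_weights
    rw [← Set.image_univ, mem_convexHull_image_iff_exists_weights]
    refine ⟨w, hw, fun i hi => (hi (Set.mem_univ i)).elim, ?_, hsum⟩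
    have h1 := G.sourceFlow_of_mem_flowPolytope hN hf
    rw [← hsum, map_sum] at h1
    simpa [G.sourceFlow_of_mem_flowPolytope hN (G.routeVector_mem_flowPolytope _)] using h1
  · rintro _ ⟨P, rfl⟩
    exact G.routeVector_mem_flowPolytope P

end Flows

end FramedGraph

/-! ### Conflicts of routes of the oruga graph -/

namespace Oruga

section Routes

variable {n : ℕ} {s : Fin n → ℕ+}

theorem edge_bounds (e : Edge s) : 1 ≤ e.1.1 ∧ e.1.1 ≤ n + 1 := by
  obtain ⟨⟨i, j⟩, h⟩ := e
  rw [mem_edgeLabels] at h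
  dsimp only
  omega

theorem edge_ext {e f : Edge s} (h1 : e.1.1 = f.1.1) (h2 : e.1.2 = f.1.2) : e = f :=
  Subtype.ext (Sigma.ext h1 (heq_of_eq h2))

theorem mem_tail_iff (m : ℕ) (hm : m ≤ n) (δ : Fin m → Fin 2) (e : Edge s) :
    e ∈ tail s m hm δ ↔
      ∃ h : e.1.1 - 1 < m, e.1.2 = (δ ⟨e.1.1 - 1, h⟩ : ℕ) * part s e.1.1 := by
  have hb := edge_bounds e
  induction m with
  | zero => simp [tail]
  | succ m ih =>
    have ih := ih (by omega) fun i => δ i.castSucc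
    rw [tail, List.mem_cons]
    refine (or_congr Iff.rfl ih).trans ?_
    constructor
    · rintro (rfl | ⟨h, he⟩)
      · exact ⟨Nat.lt_succ_self m, rfl⟩
      · exact ⟨by omega, he⟩
    · rintro ⟨h, he⟩
      by_cases hlt : e.1.1 - 1 < m
      · exact Or.inr ⟨hlt, he⟩
      · have h1 : e.1.1 = m + 1 := by omega
        refine Or.inl (edge_ext h1 ?_)
        dsimp only
        have h2 : (⟨e.1.1 - 1, h⟩ : Fin (m + 1)) = Fin.last m := Fin.ext (by simp [h1])
        rw [he, h2, h1]

theorem tail_pairwise (m : ℕ) (hm : m ≤ n) (δ : Fin m → Fin 2) :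
    (tail s m hm δ).Pairwise fun e f => f.1.1 < e.1.1 := by
  induction m with
  | zero => exact List.Pairwise.nil
  | succ m ih =>
    refine List.Pairwise.cons (fun f hf => ?_) (ih _ _)
    obtain ⟨h, -⟩ := (mem_tail_iff _ _ _ _).1 hf
    have := edge_bounds f
    dsimp only
    omega

theorem δAt_le_one (r : RouteIndex s) (a : ℕ) : r.δAt a ≤ 1 := by
  unfold RouteIndex.δAt
  split <;> omega

theorem tAt_k (r : RouteIndex s) : r.tAt r.k = r.t := by
  simp [RouteIndex.tAt]

theorem tAt_of_lt (r : RouteIndex s) {a : ℕ} (h : a < r.k) :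
    r.tAt a = r.δAt a * part s a := by
  have := δAt_le_one r a
  rw [RouteIndex.tAt, if_neg h.ne]
  split_ifs with h0
  · simp [h0]
  · have : r.δAt a = 1 := by omega
    simp [this]

theorem tAt_le_part (r : RouteIndex s) (a : ℕ) : r.tAt a ≤ part s a := by
  have := r.ht
  unfold RouteIndex.tAt
  split_ifs with h <;> simp_all
  omega

/-- The edge of a route with index `c ≤ k` is the one labelled `t_c`. -/
theorem mem_route_iff (r : RouteIndex s) (e : Edge s) :
    e ∈ (route s r).1 ↔ e.1.1 ≤ r.k ∧ e.1.2 = r.tAt e.1.1 := by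
  have hb := edge_bounds e
  have hk := r.hk
  rw [route, List.mem_cons, mem_tail_iff]
  constructor
  · rintro (rfl | ⟨h, he⟩)
    · exact ⟨le_rfl, (tAt_k r).symm⟩
    · refine ⟨by omega, ?_⟩
      rw [he, tAt_of_lt r (by omega), RouteIndex.δAt, dif_pos (by omega)]
  · rintro ⟨h, he⟩
    rcases h.eq_or_lt with h | h
    · refine Or.inl (edge_ext h ?_)
      rw [he, h, tAt_k]
    · refine Or.inr ⟨by omega, ?_⟩
      rw [he, tAt_of_lt r h, RouteIndex.δAt, dif_pos (by omega)]

theorem route_pairwise (r : RouteIndex s) :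
    (route s r).1.Pairwise fun e f => f.1.1 < e.1.1 := by
  refine List.Pairwise.cons (fun f hf => ?_) (tail_pairwise _ _ _)
  obtain ⟨h, -⟩ := (mem_tail_iff _ _ _ _).1 hf
  have := edge_bounds f
  dsimp only
  omega

theorem mem_edgeLabels_tAt (r : RouteIndex s) {c : ℕ} (h1 : 1 ≤ c) (hc : c ≤ r.k) :
    (⟨c, r.tAt c⟩ : Σ _ : ℕ, ℕ) ∈ edgeLabels s := by
  have hk := r.hk
  have ht := r.ht
  rw [mem_edgeLabels]
  rcases hc.eq_or_lt with rfl | h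
  · rw [tAt_k]
    omega
  · have := δAt_le_one r c
    rw [tAt_of_lt r h]
    obtain h0 | h0 : r.δAt c = 0 ∨ r.δAt c = 1 := by omega
    · simp [h0]
      omega
    · simp [h0]
      omega

/-- The edge `e^c_{t_c}` of a route. -/
def edgeAt (r : RouteIndex s) (c : ℕ) (h1 : 1 ≤ c) (hc : c ≤ r.k) : Edge s :=
  ⟨⟨c, r.tAt c⟩, mem_edgeLabels_tAt r h1 hc⟩

theorem edgeAt_mem (r : RouteIndex s) (c : ℕ) (h1 : 1 ≤ c) (hc : c ≤ r.k) :
    edgeAt r c h1 hc ∈ (route s r).1 :=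
  (mem_route_iff _ _).2 ⟨hc, rfl⟩

/-- The part of a route between two of its edges consists of its edges with indices in between. -/
theorem mem_middle_iff {r : RouteIndex s} {A T B : List (Edge s)} {e f : Edge s}
    (h : (route s r).1 = A ++ e :: (T ++ f :: B)) (x : Edge s) :
    x ∈ T ↔ x ∈ (route s r).1 ∧ f.1.1 < x.1.1 ∧ x.1.1 < e.1.1 := by
  have hp := route_pairwise r
  rw [h] at hp ⊢
  rw [List.pairwise_append, List.pairwise_cons, List.pairwise_append, List.pairwise_cons] at hp
  obtain ⟨-, ⟨he, -, ⟨hf, -⟩, hT⟩, hA⟩ := hp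
  simp only [List.mem_append, List.mem_cons] at *
  constructor
  · intro hx
    exact ⟨Or.inr (Or.inr (Or.inl hx)), hT x hx f (Or.inl rfl), he x (Or.inl hx)⟩
  · rintro ⟨hx | rfl | hx | rfl | hx, h1, h2⟩
    · exact absurd (hA x hx e (Or.inl rfl)) (by omega)
    · omega
    · exact hx
    · omega
    · exact absurd (hf x hx) (by omega)

/-- The conflict of two routes in terms of their parameters: for some `c > a` the edges with
indices strictly between `a` and `c` agree, the first route is smaller at `c` and larger at `a`. -/
def Conflict (r r' : RouteIndex s) : Prop :=
  ∃ c a, 1 ≤ a ∧ a < c ∧ c ≤ r.k ∧ c ≤ r'.k ∧ (∀ b, a < b → b < c → r.tAt b = r'.tAt b) ∧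
    r.tAt c < r'.tAt c ∧ r'.tAt a < r.tAt a

/-- A framing conflict between two lists with the same middle part `T` is a conflict in terms of the
parameters: the lists run through consecutive indices, so `T` holds all edges in between. -/
theorem conflict_of_lists {r r' : RouteIndex s} {A A' T B B' : List (Edge s)} {e e' f f' : Edge s}
    (h : (route s r).1 = A ++ e :: (T ++ f :: B))
    (h' : (route s r').1 = A' ++ e' :: (T ++ f' :: B'))
    (htgt : (graph s).tgt e = (graph s).tgt e') (hsrc : (graph s).src f = (graph s).src f')
    (hin : e.1.2 < e'.1.2) (hout : f'.1.2 < f.1.2) : Conflict r r' := by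
  have idx : ∀ {r : RouteIndex s} {A T B : List (Edge s)} {e f : Edge s},
      (route s r).1 = A ++ e :: (T ++ f :: B) →
        f.1.1 < e.1.1 ∧ (e.1.1 ≤ r.k ∧ e.1.2 = r.tAt e.1.1) ∧ f.1.2 = r.tAt f.1.1 ∧
          (graph s).src f = n + 1 - f.1.1 := by
    intro r A T B e f h
    have hp := route_pairwise r
    rw [h, List.pairwise_append, List.pairwise_cons] at hp
    have hlt : f.1.1 < e.1.1 := hp.2.1.1 f (by simp)
    have h1 := (mem_route_iff r e).1 (by rw [h]; simp)
    have h2 := (mem_route_iff r f).1 (by rw [h]; simp)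
    refine ⟨hlt, h1, h2.2, ?_⟩
    simp only [graph]
    have h3 := δAt_le_one r f.1.1
    have h4 := tAt_of_lt r (hlt.trans_le h1.1)
    rw [if_pos]
    rw [h2.2, h4]
    obtain h0 | h0 : r.δAt f.1.1 = 0 ∨ r.δAt f.1.1 = 1 := by omega
    · left; simp [h0]
    · right; simp [h0]
  obtain ⟨hlt, ⟨hek, het⟩, hft, hfs⟩ := idx h
  obtain ⟨hlt', ⟨hek', het'⟩, hft', hfs'⟩ := idx h'
  have he := edge_bounds e
  have he' := edge_bounds e'
  have hf := edge_bounds f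
  have hf' := edge_bounds f'
  have hee : e.1.1 = e'.1.1 := by
    simp only [graph] at htgt
    omega
  have hff : f.1.1 = f'.1.1 := by omega
  refine ⟨e.1.1, f.1.1, hf.1, hlt, hek, hee ▸ hek', fun b hb1 hb2 => ?_, ?_, ?_⟩
  · have hmem := (mem_middle_iff h (edgeAt r b (by omega) (by omega))).2
      ⟨edgeAt_mem _ _ _ _, hb1, hb2⟩
    rw [mem_middle_iff h', mem_route_iff] at hmem
    exact hmem.1.2
  · rw [← het, hee, ← het']
    exact hin
  · rw [← hft, hff, ← hft']
    exact hout

theorem conflict_of_not_coherent {r r' : RouteIndex s}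
    (h : ¬ (graph s).Coherent (route s r) (route s r')) : Conflict r r' ∨ Conflict r' r := by
  simp only [FramedGraph.Coherent, not_forall, not_not] at h
  obtain ⟨i, j, -, -, -, -, A, A', M, B, B', hP, hQ, -, -, -, -, -, h⟩ := h
  rcases h with
    ⟨⟨A₀, A₀', S, e, f, rfl, rfl, htgt, hin⟩, ⟨S', B₀, B₀', e', f', rfl, rfl, hsrc, hout⟩⟩ |
    ⟨⟨A₀, A₀', S, e, f, rfl, rfl, htgt, hin⟩, ⟨S', B₀, B₀', e', f', rfl, rfl, hsrc, hout⟩⟩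
  · exact Or.inl (conflict_of_lists (T := S ++ M ++ S') (by simpa using hP) (by simpa using hQ)
      htgt hsrc.symm hin hout)
  · exact Or.inr (conflict_of_lists (T := S ++ M ++ S') (by simpa using hQ) (by simpa using hP)
      htgt hsrc.symm hin hout)

theorem exists_split (r : RouteIndex s) {c a : ℕ} (ha : 1 ≤ a) (hac : a < c) (hc : c ≤ r.k) :
    ∃ A T B, (route s r).1 =
      A ++ edgeAt r c (by omega) hc :: (T ++ edgeAt r a ha (by omega) :: B) := by
  obtain ⟨A, B, h⟩ := List.append_of_mem (edgeAt_mem r c (by omega) hc)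
  have hp := route_pairwise r
  have hmem := edgeAt_mem r a ha (by omega)
  rw [h, List.pairwise_append] at hp
  rw [h, List.mem_append, List.mem_cons] at hmem
  rcases hmem with hm | hm | hm
  · have : c < a := hp.2.2 _ hm _ List.mem_cons_self
    omega
  · have : a = c := congrArg (fun e : Edge s => e.1.1) hm
    omega
  · obtain ⟨T, B', rfl⟩ := List.append_of_mem hm
    exact ⟨A, T, B', h⟩

/-- A conflict at `c > a` is seen at the vertex entered by the two edges with index `c`, with the
empty path as common subroute. -/
theorem not_coherent_of_conflict {r r' : RouteIndex s} (h : Conflict r r') :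
    ¬ (graph s).Coherent (route s r) (route s r') := by
  obtain ⟨c, a, ha, hac, hc, hc', hb, hin, hout⟩ := h
  have hk := r.hk
  obtain ⟨A, T, B, hP⟩ := exists_split r ha hac hc
  obtain ⟨A', T', B', hQ⟩ := exists_split r' ha hac hc'
  have hT : T = T' := by
    have hp : T.Pairwise fun e f : Edge s => f.1.1 < e.1.1 := by
      refine (route_pairwise r).sublist ?_
      rw [hP]
      exact ((List.sublist_append_left T _).cons _).trans (List.sublist_append_right A _)
    have hp' : T'.Pairwise fun e f : Edge s => f.1.1 < e.1.1 := by
      refine (route_pairwise r').sublist ?_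
      rw [hQ]
      exact ((List.sublist_append_left T' _).cons _).trans (List.sublist_append_right A' _)
    refine List.Perm.eq_of_pairwise (le := fun e f : Edge s => f.1.1 < e.1.1)
      (fun e f _ _ h1 h2 => absurd h1 h2.asymm) hp hp' ?_
    rw [List.perm_ext_iff_of_nodup]
    · intro x
      rw [mem_middle_iff hP, mem_middle_iff hQ, mem_route_iff, mem_route_iff]
      simp only [edgeAt]
      constructor
      · rintro ⟨⟨h1, h2⟩, h3, h4⟩
        exact ⟨⟨by omega, by rw [h2, hb _ h3 h4]⟩, h3, h4⟩
      · rintro ⟨⟨h1, h2⟩, h3, h4⟩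
        exact ⟨⟨by omega, by rw [h2, hb _ h3 h4]⟩, h3, h4⟩
    · exact hp.imp fun h => by rintro rfl; exact lt_irrefl _ h
    · exact hp'.imp fun h => by rintro rfl; exact lt_irrefl _ h
  subst hT
  intro hcoh
  have walk : ∀ {r : RouteIndex s} {A B : List (Edge s)} {e : Edge s},
      (route s r).1 = A ++ e :: B →
        (graph s).IsWalk 0 (A ++ [e]) ((graph s).tgt e) ∧
          (graph s).IsWalk ((graph s).tgt e) B (n + 1) := by
    intro r A B e h
    have hw := (route s r).2
    rw [h, FramedGraph.isWalk_append] at hw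
    obtain ⟨v, h1, h2, h3⟩ := hw
    exact ⟨((graph s).isWalk_append _ _ _ _).2 ⟨v, h1, h2, rfl⟩, h3⟩
  refine hcoh (n + 2 - c) (n + 2 - c) (by omega) (by omega) (by omega) (by omega)
    ⟨A ++ [edgeAt r c (by omega) hc], A' ++ [edgeAt r' c (by omega) hc'], [], _, _,
      by simpa using hP, by simpa using hQ, (walk hP).1, (walk hQ).1, rfl, (walk hP).2, (walk hQ).2,
      Or.inl ⟨⟨A, A', [], _, _, rfl, rfl, rfl, hin⟩, ⟨T, _, _, _, _, rfl, rfl, ?_, hout⟩⟩⟩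
  have src : ∀ (r : RouteIndex s) (hr : c ≤ r.k),
      (graph s).src (edgeAt r a ha (by omega)) = n + 1 - a := by
    intro r hr
    have h3 := δAt_le_one r a
    simp only [graph, edgeAt]
    rw [if_pos]
    rw [tAt_of_lt r (by omega)]
    obtain h0 | h0 : r.δAt a = 0 ∨ r.δAt a = 1 := by omega
    · left; simp [h0]
    · right; simp [h0]
  rw [src r hc, src r' hc']

end Routes

end Oruga

/-! ### Exchanging conflicting routes -/

namespace Oruga

section Exchange

variable {n : ℕ} {s : Fin n → ℕ+}

theorem routeVector_route (r : RouteIndex s) (e : Edge s) :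
    (graph s).routeVector (route s r) e =
      if e.1.1 ≤ r.k ∧ e.1.2 = r.tAt e.1.1 then 1 else 0 := by
  classical
  simp [FramedGraph.routeVector, Set.indicator_apply, mem_route_iff]

/-- The route that follows `r` up to its edge with index `c` and `r'` afterwards. -/
def RouteIndex.splice (r r' : RouteIndex s) (c : ℕ) (hc : c ≤ r'.k) : RouteIndex s where
  k := r.k
  t := r.t
  δ a := if h : a.1 + 1 < c then r'.δ ⟨a.1, by omega⟩ else r.δ a
  hk := r.hk
  ht := r.ht

theorem δAt_splice (r r' : RouteIndex s) {c : ℕ} (hc : c ≤ r'.k) (hc' : c ≤ r.k) (a : ℕ) :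
    (r.splice r' c hc).δAt a = if a < c then r'.δAt a else r.δAt a := by
  unfold RouteIndex.δAt RouteIndex.splice
  dsimp only
  by_cases h1 : 1 ≤ a ∧ a ≤ r.k - 1
  · rw [dif_pos h1]
    by_cases h2 : a < c
    · rw [dif_pos (by omega), if_pos h2, dif_pos (by omega)]
    · rw [dif_neg (by omega), if_neg h2, dif_pos h1]
  · rw [dif_neg h1, dif_neg h1]
    by_cases h2 : a < c
    · rw [if_pos h2, dif_neg (by omega)]
    · rw [if_neg h2]

theorem tAt_splice (r r' : RouteIndex s) {c : ℕ} (hc : c ≤ r'.k) (hc' : c ≤ r.k) (b : ℕ) :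
    (r.splice r' c hc).tAt b = if b < c then r'.tAt b else r.tAt b := by
  have hk : (r.splice r' c hc).k = r.k := rfl
  have ht : (r.splice r' c hc).t = r.t := rfl
  by_cases h : b < c
  · rw [if_pos h, tAt_of_lt r' (by omega), tAt_of_lt _ (by omega), δAt_splice _ _ _ hc', if_pos h]
  · rw [if_neg h]
    simp only [RouteIndex.tAt, hk, ht, δAt_splice _ _ _ hc', if_neg h]

theorem routeVector_splice (r r' : RouteIndex s) {c : ℕ} (hc : c ≤ r.k) (hc' : c ≤ r'.k) :
    (graph s).routeVector (route s r) + (graph s).routeVector (route s r') =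
      (graph s).routeVector (route s (r.splice r' c hc')) +
        (graph s).routeVector (route s (r'.splice r c hc)) := by
  have hk : (r.splice r' c hc').k = r.k := rfl
  have hk' : (r'.splice r c hc).k = r'.k := rfl
  ext e
  simp only [Pi.add_apply, routeVector_route, tAt_splice r r' hc' hc, tAt_splice r' r hc hc', hk,
    hk']
  by_cases h : e.1.1 < c
  · have h1 : e.1.1 ≤ r.k := by omega
    have h2 : e.1.1 ≤ r'.k := by omega
    simp only [h, h1, h2, true_and, if_true]
    exact add_comm _ _
  · simp only [h, if_false]

/-- The contribution of the pair `(c, a)` to `-h_ε`, extended by zero to all pairs. -/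
noncomputable def heightTerm (r : RouteIndex s) (ε : ℝ) (c a : ℕ) : ℝ :=
  if c ≤ r.k ∧ a < c then ε ^ (c - a) * ((r.tAt c : ℝ) + (r.δAt a : ℝ)) ^ 2 else 0

theorem height_eq_sum_heightTerm (r : RouteIndex s) (ε : ℝ) :
    r.height ε = -∑ c ∈ Finset.Icc 2 (n + 1), ∑ a ∈ Finset.Icc 1 n, heightTerm r ε c a := by
  have hk := r.hk
  have hinner : ∀ c ∈ Finset.Icc 2 (n + 1), ∑ a ∈ Finset.Icc 1 n, heightTerm r ε c a =
      if c ≤ r.k then ∑ a ∈ Finset.Ico 1 c,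
        ε ^ (c - a) * ((r.tAt c : ℝ) + (r.δAt a : ℝ)) ^ 2 else 0 := by
    intro c hc
    rw [Finset.mem_Icc] at hc
    split_ifs with h
    · simp only [heightTerm, h, true_and]
      rw [← Finset.sum_filter]
      refine Finset.sum_congr ?_ fun _ _ => rfl
      ext a
      simp only [Finset.mem_filter, Finset.mem_Icc, Finset.mem_Ico]
      omega
    · simp [heightTerm, h]
  rw [Finset.sum_congr rfl hinner, RouteIndex.height, ← Finset.sum_filter]
  congr 1
  symm
  refine Finset.sum_subset (fun c hc => ?_) fun c hc hc' => ?_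
  · simp only [Finset.mem_filter, Finset.mem_Icc] at hc ⊢
    omega
  · simp only [Finset.mem_filter, Finset.mem_Icc] at hc hc'
    obtain rfl : c = 1 := by omega
    simp

theorem neg_le_sq_sub_sq {x y p : ℝ} {d d' : ℕ} {A B : Prop} [Decidable A] [Decidable B]
    (hx : 0 ≤ x) (hxp : x ≤ p) (hy : 0 ≤ y) (hyp : y ≤ p) (hd : d = 0 ∨ d = 1)
    (hd' : d' = 0 ∨ d' = 1) :
    -(2 * p + 1) ≤ (if A then (x + d') ^ 2 - (x + d) ^ 2 else 0) +
      (if B then (y + d) ^ 2 - (y + d') ^ 2 else 0) := by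
  rcases hd with rfl | rfl <;> rcases hd' with rfl | rfl <;> split_ifs <;> push_cast <;>
    ring_nf <;> linarith

/-- The change of the contribution of `(c, a)` when two routes in a conflict at `c₀`, `a₀` are
exchanged for their splices at `c₀`: only pairs with `a ≤ a₀ < c₀ ≤ c` contribute, the pair
`(c₀, a₀)` contributes at least `2 ε ^ (c₀ - a₀)`, and the others come with a higher power
of `ε`. -/
theorem heightTerm_splice_ge {r r' : RouteIndex s} {c₀ a₀ : ℕ} (hac : a₀ < c₀)
    (hc : c₀ ≤ r.k) (hc' : c₀ ≤ r'.k)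
    (hb : ∀ b, a₀ < b → b < c₀ → r.tAt b = r'.tAt b) (hin : r.tAt c₀ < r'.tAt c₀)
    (hout : r'.tAt a₀ < r.tAt a₀) {ε : ℝ} (h0 : 0 < ε) (h1 : ε ≤ 1) (c a : ℕ) :
    (if c = c₀ then if a = a₀ then 2 * ε ^ (c₀ - a₀) else 0 else 0) -
        (2 * (part s c : ℝ) + 1) * ε ^ (c₀ - a₀ + 1) ≤
      heightTerm (r.splice r' c₀ hc') ε c a + heightTerm (r'.splice r c₀ hc) ε c a -
        heightTerm r ε c a - heightTerm r' ε c a := by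
  have hk : (r.splice r' c₀ hc').k = r.k := rfl
  have hk' : (r'.splice r c₀ hc).k = r'.k := rfl
  have hδ := tAt_of_lt r (hac.trans_le hc)
  have hδ' := tAt_of_lt r' (hac.trans_le hc')
  have herr : 0 ≤ (2 * (part s c : ℝ) + 1) * ε ^ (c₀ - a₀ + 1) := by positivity
  simp only [heightTerm, tAt_splice r r' hc' hc, tAt_splice r' r hc hc', δAt_splice r r' hc' hc,
    δAt_splice r' r hc hc', hk, hk']
  by_cases hcc : c < c₀
  · have e1 : c ≤ r.k := by omega
    have e2 : c ≤ r'.k := by omega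
    rw [if_neg hcc.ne]
    by_cases hca : a < c
    · have e3 : a < c₀ := by omega
      simp only [e1, e2, hca, e3, hcc, and_self, if_true]
      linarith
    · simp only [hca, and_false, if_false]
      linarith
  by_cases haa : c₀ ≤ a
  · have e3 : ¬ a < c₀ := by omega
    rw [if_neg (show a ≠ a₀ by omega), ite_self]
    simp only [hcc, e3, if_false]
    linarith
  have e3 : a < c₀ := by omega
  have e4 : a < c := by omega
  simp only [hcc, e3, e4, if_false, if_true, and_true]
  by_cases ha : a₀ < a
  · have h2 := hb a ha e3
    rw [tAt_of_lt r (by omega), tAt_of_lt r' (by omega)] at h2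
    rw [Nat.eq_of_mul_eq_mul_right (part_pos s a) h2, if_neg (show a ≠ a₀ by omega), ite_self]
    linarith
  -- the remaining pairs have `a ≤ a₀` and `c₀ ≤ c`
  have hd : (r.δAt a = 0 ∨ r.δAt a = 1) ∧ (r'.δAt a = 0 ∨ r'.δAt a = 1) := by
    have := δAt_le_one r a
    have := δAt_le_one r' a
    omega
  have ht : (r.tAt c : ℝ) ≤ part s c := by exact_mod_cast tAt_le_part r c
  have ht' : (r'.tAt c : ℝ) ≤ part s c := by exact_mod_cast tAt_le_part r' c
  have ht0 : (0 : ℝ) ≤ r.tAt c := Nat.cast_nonneg _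
  have ht0' : (0 : ℝ) ≤ r'.tAt c := Nat.cast_nonneg _
  by_cases hlead : c = c₀ ∧ a = a₀
  · obtain ⟨rfl, rfl⟩ := hlead
    rw [hδ, hδ'] at hout
    have hlt := Nat.lt_of_mul_lt_mul_right hout
    have e5 : r.δAt a = 1 := by omega
    have e6 : r'.δAt a = 0 := by omega
    have hin' : (r.tAt c : ℝ) + 1 ≤ r'.tAt c := by exact_mod_cast hin
    simp only [if_true, hc, hc', e5, e6, Nat.cast_one, Nat.cast_zero]
    have hpow : 0 < ε ^ (c - a) := by positivity
    nlinarith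
  · have hpow : ε ^ (c - a) ≤ ε ^ (c₀ - a₀ + 1) :=
      pow_le_pow_of_le_one h0.le h1 (by omega)
    have hpow0 : 0 < ε ^ (c - a) := by positivity
    have hz : (if c = c₀ then if a = a₀ then 2 * ε ^ (c₀ - a₀) else 0 else 0) = (0 : ℝ) := by
      split_ifs with h2 h3
      · exact absurd ⟨h2, h3⟩ hlead
      · rfl
      · rfl
    rw [hz]
    have hY : ∀ Y : ℝ, -(2 * (part s c : ℝ) + 1) ≤ Y →
        0 - (2 * (part s c : ℝ) + 1) * ε ^ (c₀ - a₀ + 1) ≤ ε ^ (c - a) * Y := by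
      intro Y hY
      have hp : (0 : ℝ) ≤ 2 * (part s c : ℝ) + 1 := by positivity
      nlinarith [mul_le_mul_of_nonneg_left hpow hp, mul_le_mul_of_nonneg_left hY hpow0.le]
    refine (hY ((if c ≤ r.k then ((r.tAt c : ℝ) + r'.δAt a) ^ 2 - (r.tAt c + r.δAt a) ^ 2 else 0) +
      (if c ≤ r'.k then ((r'.tAt c : ℝ) + r.δAt a) ^ 2 - (r'.tAt c + r'.δAt a) ^ 2 else 0))
      ?_).trans_eq ?_
    · exact neg_le_sq_sub_sq ht0 ht ht0' ht' hd.1 hd.2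
    · split_ifs <;> ring

/-- There are no conflicts for `n = 1`: a conflict needs two edges into an inner vertex, and since
`s_{n+1} = 2` the vertex next to the source is entered by a single edge. -/
theorem Conflict.two_le {r r' : RouteIndex s} (h : Conflict r r') : 2 ≤ n := by
  obtain ⟨c, a, ha, hac, hc, hc', -, hin, -⟩ := h
  have hk := r.hk
  have hk' := r'.hk
  by_contra hn
  have e1 : r.k = n + 1 := by omega
  have e2 : r'.k = n + 1 := by omega
  have ht := r.ht
  have ht' := r'.ht
  have e3 : c = n + 1 := by omega
  have e4 := tAt_k r
  have e5 := tAt_k r'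
  rw [e1, part_last] at ht
  rw [e2, part_last] at ht'
  rw [e1, ← e3] at e4
  rw [e2, ← e3] at e5
  omega

theorem exists_exchange_of_conflict {r r' : RouteIndex s} (h : Conflict r r') {ε : ℝ} (h0 : 0 < ε)
    (hε : ε < 1 / ((n : ℝ) * (1 + ∑ j ∈ Finset.Icc 2 n, (2 * (part s j : ℝ) + 1)))) :
    ∃ p p' : RouteIndex s,
      (graph s).routeVector (route s r) + (graph s).routeVector (route s r') =
        (graph s).routeVector (route s p) + (graph s).routeVector (route s p') ∧
      p.height ε + p'.height ε < r.height ε + r'.height ε := by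
  have hn := h.two_le
  obtain ⟨c₀, a₀, ha, hac, hc, hc', hb, hin, hout⟩ := h
  refine ⟨r.splice r' c₀ hc', r'.splice r c₀ hc, routeVector_splice r r' hc hc', ?_⟩
  have hk := r.hk
  set S : ℝ := ∑ j ∈ Finset.Icc 2 n, (2 * (part s j : ℝ) + 1) with hS
  have hS3 : 3 ≤ S := by
    have h2 := Finset.single_le_sum (f := fun j => 2 * (part s j : ℝ) + 1)
      (fun j _ => by positivity) (Finset.mem_Icc.2 ⟨le_rfl, hn⟩)
    have h3 : (1 : ℝ) ≤ part s 2 := by exact_mod_cast part_pos s 2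
    rw [← hS] at h2
    linarith
  have hn' : (2 : ℝ) ≤ n := by exact_mod_cast hn
  have hlt : ε * (n * (1 + S)) < 1 := (lt_div_iff₀ (by positivity)).1 hε
  have h1 : ε ≤ 1 := by nlinarith [mul_nonneg h0.le (by nlinarith : 0 ≤ n * (1 + S) - 1)]
  have hS' : ∑ j ∈ Finset.Icc 2 (n + 1), (2 * (part s j : ℝ) + 1) = S + 5 := by
    rw [Finset.sum_Icc_succ_top (by omega), part_last, ← hS]
    norm_num
  have hsum := Finset.sum_le_sum fun c (_ : c ∈ Finset.Icc 2 (n + 1)) =>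
    Finset.sum_le_sum fun a (_ : a ∈ Finset.Icc 1 n) =>
      heightTerm_splice_ge hac hc hc' hb hin hout h0 h1 c a
  simp only [Finset.sum_sub_distrib, Finset.sum_add_distrib, Finset.sum_const] at hsum
  have hlead : ∑ c ∈ Finset.Icc 2 (n + 1), ∑ a ∈ Finset.Icc 1 n,
      (if c = c₀ then if a = a₀ then 2 * ε ^ (c₀ - a₀) else 0 else 0) = 2 * ε ^ (c₀ - a₀) := by
    rw [Finset.sum_eq_single c₀, Finset.sum_eq_single a₀]
    · simp
    · intro b _ hb
      simp [hb]
    · intro hmem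
      exact absurd (Finset.mem_Icc.2 (by omega)) hmem
    · intro b _ hb
      simp [hb]
    · intro hmem
      exact absurd (Finset.mem_Icc.2 (by omega)) hmem
  rw [hlead, ← Finset.smul_sum, ← Finset.sum_mul, hS', Nat.card_Icc, Nat.add_sub_cancel,
    nsmul_eq_mul] at hsum
  have hpos : 0 < ε ^ (c₀ - a₀) := by positivity
  -- `S + 5 ≤ 2 (1 + S)` since `S ≥ 3`
  have herr : n * ((S + 5) * ε ^ (c₀ - a₀ + 1)) < 2 * ε ^ (c₀ - a₀) := by
    have h2 : ε * (n * (S + 5)) < 2 := by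
      nlinarith [mul_nonneg (mul_nonneg h0.le (by linarith : (0 : ℝ) ≤ n))
        (by linarith : 0 ≤ S - 3)]
    rw [pow_succ]
    nlinarith [mul_lt_mul_of_pos_right h2 hpos]
  rw [height_eq_sum_heightTerm, height_eq_sum_heightTerm, height_eq_sum_heightTerm r,
    height_eq_sum_heightTerm r']
  linarith

end Exchange

end Oruga

/-! ### Weights on cliques are determined by their flow -/

namespace Oruga

section Uniqueness

variable {n : ℕ} {s : Fin n → ℕ+}

/-- The label of the edge of a route with index `c`, shifted by one; it is `0` if there is no such
edge. -/
def label (r : RouteIndex s) (c : ℕ) : ℕ :=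
  if c ≤ r.k then r.tAt c + 1 else 0

theorem label_of_le {r : RouteIndex s} {c : ℕ} (h : c ≤ r.k) : label r c = r.tAt c + 1 :=
  if_pos h

theorem label_of_gt {r : RouteIndex s} {c : ℕ} (h : r.k < c) : label r c = 0 :=
  if_neg (not_le.2 h)

theorem label_eq_succ_iff (r : RouteIndex s) (c j : ℕ) :
    label r c = j + 1 ↔ c ≤ r.k ∧ r.tAt c = j := by
  unfold label
  split_ifs with h <;> simp [h]

theorem le_of_label_eq {r q : RouteIndex s} {c : ℕ} (h : label r c = label q c) (hc : c ≤ r.k) :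
    c ≤ q.k ∧ r.tAt c = q.tAt c := by
  rw [label_of_le hc, eq_comm, label_eq_succ_iff] at h
  exact ⟨h.1, h.2.symm⟩

/-- An edge whose label is that of a source-edge is the first edge of a route. -/
theorem k_eq_of_tAt {r : RouteIndex s} {c : ℕ} (hc : c ≤ r.k) (h1 : 1 ≤ r.tAt c)
    (h2 : r.tAt c ≤ part s c - 1) : r.k = c := by
  by_contra hne
  have h3 := δAt_le_one r c
  rw [tAt_of_lt r (by omega)] at h1 h2
  obtain h0 | h0 : r.δAt c = 0 ∨ r.δAt c = 1 := by omega
  · simp [h0] at h1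
  · simp only [h0, one_mul] at h1 h2
    omega

/-- The labels of the edges of a route with indices at least `i`, that is, of its part up to the
vertex entered by the edges with index `i`. -/
def prefixLabels (i : ℕ) (r : RouteIndex s) (c : ℕ) : ℕ :=
  if i ≤ c then label r c else 0

theorem prefixLabels_eq_iff {i : ℕ} {r q : RouteIndex s} :
    prefixLabels i r = prefixLabels i q ↔ ∀ c, i ≤ c → label r c = label q c := by
  constructor
  · intro h c hc
    simpa [prefixLabels, hc] using congrFun h c
  · intro h
    funext c
    unfold prefixLabels
    split_ifs with hc
    · exact h c hc
    · rfl

theorem prefixLabels_eq_iff_succ {i : ℕ} {r q : RouteIndex s} :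
    prefixLabels i r = prefixLabels i q ↔
      prefixLabels (i + 1) r = prefixLabels (i + 1) q ∧ label r i = label q i := by
  simp only [prefixLabels_eq_iff]
  constructor
  · exact fun h => ⟨fun c hc => h c (by omega), h i le_rfl⟩
  · rintro ⟨h, hi⟩ c hc
    rcases hc.eq_or_lt with rfl | hc
    · exact hi
    · exact h c hc

theorem lt_k_of_prefixLabels_eq {i : ℕ} {r q : RouteIndex s}
    (h : prefixLabels (i + 1) q = prefixLabels (i + 1) r) (hr : i < r.k) : i < q.k := by
  have := le_of_label_eq (prefixLabels_eq_iff.1 h.symm r.k hr) le_rfl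
  omega

/-- The edges with indices at least `1` are all edges, so this prefix is the whole route. -/
theorem eq_of_prefixLabels_one_eq {r q : RouteIndex s}
    (h : prefixLabels 1 r = prefixLabels 1 q) : r = q := by
  rw [prefixLabels_eq_iff] at h
  have h1 := le_of_label_eq (h r.k r.hk.1) le_rfl
  have h2 := le_of_label_eq (h q.k q.hk.1).symm le_rfl
  have hk : r.k = q.k := by omega
  apply (route_bijective s).1
  apply Subtype.ext
  refine List.Perm.eq_of_pairwise (le := fun e f : Edge s => f.1.1 < e.1.1)
    (fun e f _ _ h1 h2 => absurd h1 h2.asymm) (route_pairwise r) (route_pairwise q) ?_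
  rw [List.perm_ext_iff_of_nodup ((graph s).nodup_of_isWalk (route s r).2)
    ((graph s).nodup_of_isWalk (route s q).2)]
  intro e
  have he := edge_bounds e
  rw [mem_route_iff, mem_route_iff, hk]
  refine and_congr_right fun hle => ?_
  rw [(le_of_label_eq (h e.1.1 he.1) (hk ▸ hle)).2]

/-- Two different prefixes differ at some edge for the last time before they merge, and this edge
is present in both. -/
theorem exists_last_difference {i : ℕ} {r q : RouteIndex s} (hr : i < r.k) (hq : i < q.k)
    (hne : prefixLabels (i + 1) r ≠ prefixLabels (i + 1) q) :
    ∃ c, i < c ∧ c ≤ r.k ∧ c ≤ q.k ∧ (∀ b, i < b → b < c → r.tAt b = q.tAt b) ∧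
      r.tAt c ≠ q.tAt c := by
  have hex : ∃ c, i < c ∧ label r c ≠ label q c := by
    by_contra hn
    push Not at hn
    exact hne (prefixLabels_eq_iff.2 fun c hc => hn c hc)
  classical
  obtain ⟨hc, hlab⟩ := Nat.find_spec hex
  have hmin : ∀ b, i < b → b < Nat.find hex → label r b = label q b := fun b h1 h2 => by
    by_contra hn
    exact Nat.find_min hex h2 ⟨h1, hn⟩
  set c := Nat.find hex
  -- beyond the first edge of one route the two prefixes would already agree
  have key : ∀ {p p' : RouteIndex s}, i < p.k → (∀ b, i < b → b < c → label p b = label p' b) →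
      label p c ≠ label p' c → c ≤ p.k := by
    intro p p' hp hm hl
    by_contra hgt
    have h1 := le_of_label_eq (hm p.k hp (by omega)) le_rfl
    rw [tAt_k] at h1
    have h2 := k_eq_of_tAt h1.1 (by have := p.ht; omega) (by have := p.ht; omega)
    rw [label_of_gt (by omega), label_of_gt (by omega)] at hl
    exact hl rfl
  have hcr := key hr hmin hlab
  have hcq := key hq (fun b h1 h2 => (hmin b h1 h2).symm) hlab.symm
  refine ⟨c, hc, hcr, hcq, fun b h1 h2 => (le_of_label_eq (hmin b h1 h2) (by omega)).2, ?_⟩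
  rw [label_of_le hcr, label_of_le hcq] at hlab
  omega

/-- If two different prefixes are each continued both by a bump and by a dip, then the lower prefix
with a dip and the upper prefix with a bump are in conflict. -/
theorem conflict_of_prefixes {i : ℕ} (hi : 1 ≤ i) {r₁ r₂ q₁ q₂ : RouteIndex s} (hr : i < r₁.k)
    (hq : i < q₁.k)
    (hrr : prefixLabels (i + 1) r₂ = prefixLabels (i + 1) r₁)
    (hqq : prefixLabels (i + 1) q₂ = prefixLabels (i + 1) q₁)
    (hne : prefixLabels (i + 1) r₁ ≠ prefixLabels (i + 1) q₁)
    (hr1 : r₁.tAt i = 0) (hq1 : q₁.tAt i = 0) (hr2 : r₂.tAt i ≠ 0) (hq2 : q₂.tAt i ≠ 0) :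
    Conflict r₂ q₁ ∨ Conflict q₂ r₁ := by
  obtain ⟨c, hic, hcr, hcq, hb, hc⟩ := exists_last_difference hr hq hne
  rw [prefixLabels_eq_iff] at hrr hqq
  have er : ∀ b, i < b → b ≤ c → b ≤ r₂.k ∧ r₂.tAt b = r₁.tAt b := fun b h1 h2 => by
    have := le_of_label_eq (hrr b h1).symm (by omega)
    exact ⟨this.1, this.2.symm⟩
  have eq : ∀ b, i < b → b ≤ c → b ≤ q₂.k ∧ q₂.tAt b = q₁.tAt b := fun b h1 h2 => by
    have := le_of_label_eq (hqq b h1).symm (by omega)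
    exact ⟨this.1, this.2.symm⟩
  rcases hc.lt_or_gt with hlt | hlt
  · refine Or.inl ⟨c, i, hi, hic, (er c hic le_rfl).1, hcq, fun b h1 h2 => ?_, ?_, ?_⟩
    · rw [(er b h1 h2.le).2, hb b h1 h2]
    · rwa [(er c hic le_rfl).2]
    · omega
  · refine Or.inr ⟨c, i, hi, hic, (eq c hic le_rfl).1, hcr, fun b h1 h2 => ?_, ?_, ?_⟩
    · rw [(eq b h1 h2.le).2, hb b h1 h2]
    · rwa [(eq c hic le_rfl).2]
    · omega

variable [Fintype (RouteIndex s)]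

open Classical in
/-- In a clique the prefixes at a vertex and the edges by which they are continued are ordered in
the same way, so the weights of the prefixes and the total weight of the bump determine how much of
each prefix is continued by the bump. -/
theorem bump_weight_le {w w' : RouteIndex s → ℝ} (hw : ∀ r, 0 ≤ w r) (hw' : ∀ r, 0 ≤ w' r)
    (hC : ∀ r q, w r ≠ 0 → w q ≠ 0 → ¬ Conflict r q)
    (hC' : ∀ r q, w' r ≠ 0 → w' q ≠ 0 → ¬ Conflict r q) {i : ℕ} (hi : 1 ≤ i)
    (hpre : ∀ r : RouteIndex s, i < r.k →
      ∑ q with prefixLabels (i + 1) q = prefixLabels (i + 1) r, w q =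
      ∑ q with prefixLabels (i + 1) q = prefixLabels (i + 1) r, w' q)
    (hbump : ∑ q : RouteIndex s with label q i = 1, w q =
      ∑ q : RouteIndex s with label q i = 1, w' q)
    (r : RouteIndex s) (hr : i < r.k) :
    ∑ q ∈ {q | label q i = 1} with prefixLabels (i + 1) q = prefixLabels (i + 1) r, w q ≤
      ∑ q ∈ {q | label q i = 1} with prefixLabels (i + 1) q = prefixLabels (i + 1) r, w' q := by
  by_contra! hlt
  have hmaps : ∀ q ∈ ({q | label q i = 1} : Finset (RouteIndex s)),
      prefixLabels (i + 1) q ∈ Finset.univ.image (prefixLabels (s := s) (i + 1)) :=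
    fun q _ => Finset.mem_image_of_mem _ (Finset.mem_univ q)
  -- the totals agree, so some other prefix is continued less often by the bump in `w`
  obtain ⟨y, -, hy⟩ : ∃ y ∈ Finset.univ.image (prefixLabels (s := s) (i + 1)),
      ∑ q ∈ {q | label q i = 1} with prefixLabels (i + 1) q = y, w q <
        ∑ q ∈ {q | label q i = 1} with prefixLabels (i + 1) q = y, w' q := by
    by_contra! hall
    have := Finset.sum_lt_sum hall ⟨_, Finset.mem_image_of_mem _ (Finset.mem_univ r), hlt⟩
    rw [Finset.sum_fiberwise_of_maps_to hmaps, Finset.sum_fiberwise_of_maps_to hmaps] at this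
    exact this.ne' hbump
  -- the first edge of a route is not a bump
  have bump : ∀ {q : RouteIndex s}, label q i = 1 → q.tAt i = 0 ∧ i < q.k := by
    intro q hq
    obtain ⟨h1, h2⟩ := (label_eq_succ_iff q i 0).1 hq
    refine ⟨h2, lt_of_le_of_ne h1 ?_⟩
    rintro rfl
    have := q.ht
    rw [tAt_k] at h2
    omega
  have dip : ∀ {p q : RouteIndex s}, prefixLabels (i + 1) q = prefixLabels (i + 1) p → i < p.k →
      label q i ≠ 1 → q.tAt i ≠ 0 := by
    intro p q h hp hq h0
    exact hq ((label_eq_succ_iff q i 0).2 ⟨(lt_k_of_prefixLabels_eq h hp).le, h0⟩)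
  have split : ∀ (v : RouteIndex s → ℝ) (p : RouteIndex s),
      ∑ q with prefixLabels (i + 1) q = prefixLabels (i + 1) p, v q =
        ∑ q ∈ {q | label q i = 1} with prefixLabels (i + 1) q = prefixLabels (i + 1) p, v q +
        ∑ q ∈ {q | label q i ≠ 1} with prefixLabels (i + 1) q = prefixLabels (i + 1) p, v q := by
    intro v p
    rw [← Finset.sum_filter_add_sum_filter_not _ (fun q => label q i = 1), Finset.filter_comm,
      Finset.filter_comm (fun q => ¬ label q i = 1)]
  obtain ⟨q₁, hq₁, hwq₁⟩ := Finset.exists_lt_of_sum_lt hy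
  simp only [Finset.mem_filter, Finset.mem_univ, true_and] at hq₁
  obtain ⟨hq₁l, rfl⟩ := hq₁
  obtain ⟨hq₁0, hq₁k⟩ := bump hq₁l
  have hsr := hpre r hr
  have hsq := hpre q₁ hq₁k
  rw [split w, split w'] at hsr hsq
  obtain ⟨r₁, hr₁, hwr₁⟩ := Finset.exists_lt_of_sum_lt hlt
  obtain ⟨r₂, hr₂, hwr₂⟩ := Finset.exists_lt_of_sum_lt
    (show ∑ q ∈ {q | label q i ≠ 1} with prefixLabels (i + 1) q = prefixLabels (i + 1) r, w q <
      ∑ q ∈ {q | label q i ≠ 1} with prefixLabels (i + 1) q = prefixLabels (i + 1) r, w' q by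
      linarith)
  obtain ⟨q₂, hq₂, hwq₂⟩ := Finset.exists_lt_of_sum_lt
    (show ∑ q ∈ {q | label q i ≠ 1} with prefixLabels (i + 1) q = prefixLabels (i + 1) q₁, w' q <
      ∑ q ∈ {q | label q i ≠ 1} with prefixLabels (i + 1) q = prefixLabels (i + 1) q₁, w q by
      linarith)
  simp only [Finset.mem_filter, Finset.mem_univ, true_and] at hr₁ hr₂ hq₂
  obtain ⟨hr₁0, hr₁k⟩ := bump hr₁.1
  have hne : prefixLabels (i + 1) r₁ ≠ prefixLabels (i + 1) q₁ := by
    intro h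
    rw [← h, hr₁.2] at hy
    exact hy.asymm hlt
  rcases conflict_of_prefixes hi hr₁k hq₁k (hr₂.2.trans hr₁.2.symm) hq₂.2 hne hr₁0 hq₁0
    (dip hr₂.2 hr hr₂.1) (dip hq₂.2 hq₁k hq₂.1) with h | h
  · exact hC' _ _ ((hw r₂).trans_lt hwr₂).ne' ((hw q₁).trans_lt hwq₁).ne' h
  · exact hC _ _ ((hw' q₂).trans_lt hwq₂).ne' ((hw' r₁).trans_lt hwr₁).ne' h

open Classical in
/-- The flow determines the weight of every prefix, by induction from the source to the sink. -/
theorem prefix_weight_eq {w w' : RouteIndex s → ℝ} (hw : ∀ r, 0 ≤ w r) (hw' : ∀ r, 0 ≤ w' r)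
    (hC : ∀ r q, w r ≠ 0 → w q ≠ 0 → ¬ Conflict r q)
    (hC' : ∀ r q, w' r ≠ 0 → w' q ≠ 0 → ¬ Conflict r q)
    (hflow : ∀ c j, 1 ≤ c → ∑ q : RouteIndex s with label q c = j + 1, w q =
      ∑ q : RouteIndex s with label q c = j + 1, w' q)
    (m : ℕ) : ∀ i, 1 ≤ i → i + m = n + 2 → ∀ r : RouteIndex s, i ≤ r.k →
      ∑ q with prefixLabels i q = prefixLabels i r, w q =
        ∑ q with prefixLabels i q = prefixLabels i r, w' q := by
  induction m with
  | zero =>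
    intro i _ him r hr
    have := r.hk
    omega
  | succ m ih =>
    intro i hi him r hr
    have hpre := ih (i + 1) (by omega) (by omega)
    rcases hr.eq_or_lt with rfl | hr
    · -- the route starts with a source-edge, which no other prefix uses
      have hset : ∀ q : RouteIndex s,
          prefixLabels r.k q = prefixLabels r.k r ↔ label q r.k = r.t + 1 := by
        intro q
        rw [prefixLabels_eq_iff]
        constructor
        · intro h
          rw [h _ le_rfl, label_of_le le_rfl, tAt_k]
        · intro h c hc
          have ht := r.ht
          obtain ⟨h1, h2⟩ := (label_eq_succ_iff _ _ _).1 h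
          have h3 := k_eq_of_tAt h1 (by omega) (by omega)
          rcases hc.eq_or_lt with rfl | hc
          · rw [h, label_of_le le_rfl, tAt_k]
          · rw [label_of_gt hc, label_of_gt (by omega)]
      simp only [hset]
      exact hflow _ _ hi
    · have h1 := hflow i 0 hi
      rw [zero_add] at h1
      have hbump := le_antisymm (bump_weight_le hw hw' hC hC' hi hpre h1 r hr)
        (bump_weight_le hw' hw hC' hC hi (fun r hr => (hpre r hr).symm) h1.symm r hr)
      have hset : ∀ (v : RouteIndex s → ℝ), ∑ q with prefixLabels i q = prefixLabels i r, v q =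
          if label r i = 1 then
            ∑ q ∈ {q | label q i = 1} with prefixLabels (i + 1) q = prefixLabels (i + 1) r, v q
          else ∑ q with prefixLabels (i + 1) q = prefixLabels (i + 1) r, v q -
            ∑ q ∈ {q | label q i = 1} with prefixLabels (i + 1) q = prefixLabels (i + 1) r,
              v q := by
        intro v
        split_ifs with hl
        · refine Finset.sum_congr ?_ fun _ _ => rfl
          ext q
          simp only [Finset.mem_filter, Finset.mem_univ, true_and]
          rw [prefixLabels_eq_iff_succ, hl]
          exact and_comm
        · rw [eq_sub_iff_add_eq, add_comm, Finset.filter_comm,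
            ← Finset.sum_filter_add_sum_filter_not
              (Finset.univ.filter fun q => prefixLabels (i + 1) q = prefixLabels (i + 1) r)
              (fun q => label q i = 1)]
          congr 1
          refine Finset.sum_congr ?_ fun _ _ => rfl
          ext q
          simp only [Finset.mem_filter, Finset.mem_univ, true_and]
          rw [prefixLabels_eq_iff_succ]
          refine and_congr_right fun hq => ?_
          -- after the first edge there are only two possible labels
          have two : ∀ p : RouteIndex s, i < p.k → label p i = 1 ∨ label p i = part s i + 1 := by
            intro p hp
            have := δAt_le_one p i
            rw [label_of_le hp.le, tAt_of_lt p hp]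
            obtain h0 | h0 : p.δAt i = 0 ∨ p.δAt i = 1 := by omega
            · simp [h0]
            · simp [h0]
          have h2 := two r hr
          have h3 := two q (lt_k_of_prefixLabels_eq hq hr)
          have h4 := part_pos s i
          omega
      rw [hset, hset, hpre r hr, hbump]

/-- Nonnegative weights on a clique are determined by their flow. -/
theorem weights_eq_of_flow_eq {w w' : RouteIndex s → ℝ} (hw : ∀ r, 0 ≤ w r)
    (hw' : ∀ r, 0 ≤ w' r) (hC : ∀ r q, w r ≠ 0 → w q ≠ 0 → ¬ Conflict r q)
    (hC' : ∀ r q, w' r ≠ 0 → w' q ≠ 0 → ¬ Conflict r q)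
    (hsum : ∑ r, w r • (graph s).routeVector (route s r) =
      ∑ r, w' r • (graph s).routeVector (route s r)) : w = w' := by
  classical
  have hflow : ∀ c j, 1 ≤ c →
      ∑ q : RouteIndex s with label q c = j + 1, w q =
        ∑ q : RouteIndex s with label q c = j + 1, w' q := by
    intro c j hc
    by_cases he : (⟨c, j⟩ : Σ _ : ℕ, ℕ) ∈ edgeLabels s
    · have h := congrFun hsum ⟨_, he⟩
      simp only [Finset.sum_apply, Pi.smul_apply, routeVector_route, smul_eq_mul, mul_ite, mul_one,
        mul_zero, ← Finset.sum_filter] at h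
      simpa only [label_eq_succ_iff, eq_comm (a := j)] using h
    · have hemp : (Finset.univ.filter fun q : RouteIndex s => label q c = j + 1) = ∅ := by
        refine Finset.filter_eq_empty_iff.2 fun q _ hq => he ?_
        obtain ⟨h1, rfl⟩ := (label_eq_succ_iff _ _ _).1 hq
        exact mem_edgeLabels_tAt q hc h1
      rw [hemp, Finset.sum_empty, Finset.sum_empty]
  funext r
  have h := prefix_weight_eq hw hw' hC hC' hflow (n + 1) 1 le_rfl (by omega) r r.hk.1
  have hset : (Finset.univ.filter fun q => prefixLabels 1 q = prefixLabels 1 r) = {r} := by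
    ext q
    simp only [Finset.mem_filter, Finset.mem_univ, true_and, Finset.mem_singleton]
    exact ⟨eq_of_prefixLabels_one_eq, fun h => h ▸ rfl⟩
  rwa [hset, Finset.sum_singleton, Finset.sum_singleton] at h

end Uniqueness

/-! ### Admissibility of the height function -/

theorem isAdmissibleHeight_height {n : ℕ} (s : Fin n → ℕ+) {ε : ℝ} (h0 : 0 < ε)
    (hε : ε < 1 / ((n : ℝ) * (1 + ∑ j ∈ Finset.Icc 2 n, (2 * (part s j : ℝ) + 1)))) :
    IsAdmissibleHeight (graph s).flowPolytope (graph s).routeVector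
      (graph s).dkkTriangulation (height s ε) := by
  have := (graph s).finite_route
  have := Fintype.ofFinite (graph s).Route
  have : Fintype (RouteIndex s) := Fintype.ofEquiv _ (routeEquiv s).symm
  have : Nonempty (graph s).Route := ⟨route s ⟨n + 1, 1, fun _ => 0, by omega, by
    simp [part_last]⟩⟩
  rw [(graph s).flowPolytope_eq_convexHull n.succ_pos]
  refine isAdmissibleHeight_of_exchange (Coh := (graph s).Coherent) (graph s).sourceFlow
    (fun P => (graph s).sourceFlow_of_mem_flowPolytope n.succ_pos
      ((graph s).routeVector_mem_flowPolytope P)) ?_ ?_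
  · intro P Q hPQ
    obtain ⟨r, rfl⟩ := (route_bijective s).2 P
    obtain ⟨q, rfl⟩ := (route_bijective s).2 Q
    rcases conflict_of_not_coherent hPQ with h | h
    · obtain ⟨p, p', h1, h2⟩ := exists_exchange_of_conflict h h0 hε
      refine ⟨route s p, route s p', h1, ?_⟩
      simpa only [height_route] using h2
    · obtain ⟨p, p', h1, h2⟩ := exists_exchange_of_conflict h h0 hε
      refine ⟨route s p, route s p', by rw [add_comm, h1], ?_⟩
      simp only [height_route]
      linarith
  · intro w w' hw hw' hC hC' hsum
    have conv : ∀ v : (graph s).Route → ℝ, ∑ P, v P • (graph s).routeVector P =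
        ∑ r, v (route s r) • (graph s).routeVector (route s r) := fun v =>
      ((routeEquiv s).sum_comp fun P => v P • (graph s).routeVector P).symm
    rw [conv, conv] at hsum
    have h := weights_eq_of_flow_eq (w := fun r => w (route s r)) (w' := fun r => w' (route s r))
      (fun r => hw _) (fun r => hw' _)
      (fun r q hr hq hc => not_coherent_of_conflict hc (hC _ _ hr hq))
      (fun r q hr hq hc => not_coherent_of_conflict hc (hC' _ _ hr hq)) hsum
    funext P
    obtain ⟨r, rfl⟩ := (route_bijective s).2 P
    exact congrFun h r

end Oruga

theorem mainTheorem8 (n : ℕ) (hn : 1 ≤ n) (s : Fin n → ℕ+) :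
    (∃ ε₀ : ℝ, 0 < ε₀ ∧ ∀ ε : ℝ, 0 < ε → ε < ε₀ →
      IsAdmissibleHeight (Oruga.graph s).flowPolytope (Oruga.graph s).routeVector
        (Oruga.graph s).dkkTriangulation (Oruga.height s ε)) ∧
    (∀ ε : ℝ, 0 < ε →
      ε < 1 / ((n : ℝ) * (1 + ∑ j ∈ Finset.Icc 2 n, (2 * (Oruga.part s j : ℝ) + 1))) →
      IsAdmissibleHeight (Oruga.graph s).flowPolytope (Oruga.graph s).routeVector
        (Oruga.graph s).dkkTriangulation (Oruga.height s ε)) := by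
  have hn' : (0 : ℝ) < n := by exact_mod_cast hn
  exact ⟨⟨1 / ((n : ℝ) * (1 + ∑ j ∈ Finset.Icc 2 n, (2 * (Oruga.part s j : ℝ) + 1))),
    by positivity, fun ε => Oruga.isAdmissibleHeight_height s⟩,
    fun ε => Oruga.isAdmissibleHeight_height s⟩
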